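/- **Conventions.** A *C\*-planar algebra* is a family $\mathscr P=\{\mathscr P_{n,\pm}\}_{n\ge 0}$ of finite-dimensional complex vector spaces on which the shaded planar tangles act: every shaded planar tangle $T$, considered up to isotopy, with input discs of types $(n_i,\varepsilon_i)$ and output disc of type $(n_0,\varepsilon_0)$ (a disc of type $(n,\pm)$ has $2n$ marked boundary points and a distinguished \$-interval, which bounds an unshaded region for $+$ and a shaded one for $-$) gives a multilinear map $Z_T:\prod_i\mathscr P_{n_i,\varepsilon_i}\to\mathscr P_{n_0,\varepsilon_0}$, compatibly with the gluing of tangles, the relabelling of input discs and the identity tangles. Moreover each $\mathscr P_{n,\pm}$ is a C\*-algebra whose product and unit are given by the multiplication tangle and the tangle of $n$ vertical strings; the involutions satisfy $Z_T(x_1,\dots,x_m)^*=Z_{T^*}(x_1^*,\dots,x_m^*)$, where $T^*$ is the mirror image of $T$; and there are linear functionals $tr_{0,\pm}$ on $\mathscr P_{0,\pm}$ such that, for all $n$, the functional $tr_{n,\pm}(x)=tr_{0,\pm}(\text{right closure of }x)$ on $\mathscr P_{n,\pm}$ is positive and faithful, i.e. $tr_{n,\pm}(x^*x)>0$ for $x\ne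 0$. Draw elements of $\mathscr P_{2,\pm}$ as boxes with two points on top, two points at the bottom and \$ on the left. The product $xy$ has $y$ on top of $x$. The Fourier transform $\mathfrak F:\mathscr P_{2,\pm}\to\mathscr P_{2,\mp}$, $\widehat x=\mathfrak F(x)$, is the clockwise rotation by $90^\circ$. The convolution $a*b$ of $a,b\in\mathscr P_{2,\pm}$ is given by the tangle with $a$ on the left and $b$ on the right, in which the two right points of $a$ are joined to the two left points of $b$ (top to top, bottom to bottom); equivalently $a*b=\mathfrak F^{-1}(\mathfrak F(b)\mathfrak F(a))$. An element $x\in\mathscr P_{2,\pm}$ is *$\mathfrak F$-positive* if $\widehat x$ is a positive element of the C\*-algebra $\mathscr P_{2,\mp}$, i.e. $\widehat x=zz^*$ for some $z\in\mathscr P_{2,\mp}$. **Proposition.** Let $\mathscr P$ be a C\*-planar algebra with $\mathscr P_{2,\pm}\neq 0$, let $x\in\mathscr P_{2,\pm}$ be $\mathfrak F$-positive, and let $r$ be the spectral radius of $x$ in the algebra $\mathscr P_{2,\pm}$. Then there exists a non-zero $\mathfrak F$-positive $y\in\mathscr P_{2,\pm}$ such that $$xy=yx=r\,y,$$ equivalently,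 $$\widehat x*\widehat y=\widehat y*\widehat x=r\,\widehat y .$$ -/

import Mathlib

universe u

/-!
Shaded planar tangles are encoded up to isotopy.  An isotopy class of shaded planar tangles in a
disc with holes is recorded by its finite set of regions (with their shading), its finite set of
closed strings, the way the remaining strings pair the marked boundary points, and, for every
boundary interval of every disc, the region that it bounds.  Planarity is Euler's formula
`V - E + F = 1 + C`.
-/

namespace PlanarTangle

/-- The colour `(n, s)` of a disc with `2 * n` marked boundary points; `s` is the shading of the
region at its `$`-interval: `false` is unshaded (the sign `+`), `true` is shaded (the sign `-`). -/
abbrev Colour := ℕ × Bool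

/-- The shading of the `j`-th boundary interval of a disc whose `$`-interval has shading `s`. -/
def alternate (s : Bool) (j : ℕ) : Bool := s ^^ decide (j % 2 = 1)

/-- The marked points of a tangle with output disc of colour `out` and input discs of colours
`col i`.  On every disc the points are numbered `0, …, 2 * n - 1` clockwise, starting at `$`. -/
abbrev Point {ι : Type} (col : ι → Colour) (out : Colour) : Type :=
  Fin (2 * out.1) ⊕ (Σ i : ι, Fin (2 * (col i).1))

/-- The disc on which a marked point lies; `none` is the output disc. -/
def Point.disc {ι : Type} {col : ι → Colour} {out : Colour} : Point col out → Option ι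
  | Sum.inl _ => none
  | Sum.inr x => some x.1

/-- The region clockwise before a marked point, given the regions at the boundary intervals. -/
def before {ι : Type} {col : ι → Colour} {out : Colour} {R : Type}
    (regOut : Fin (2 * out.1 + 1) → R) (regIn : (i : ι) → Fin (2 * (col i).1 + 1) → R) :
    Point col out → R
  | Sum.inl p => regOut p.castSucc
  | Sum.inr x => regIn x.1 x.2.castSucc

/-- The region clockwise after a marked point, given the regions at the boundary intervals. -/
def after {ι : Type} {col : ι → Colour} {out : Colour} {R : Type}
    (regOut : Fin (2 * out.1 + 1) → R) (regIn : (i : ι) → Fin (2 * (col i).1 + 1) → R) :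
    Point col out → R
  | Sum.inl p => regOut p.succ
  | Sum.inr x => regIn x.1 x.2.succ

/-- Two regions touch if they meet the boundary of a common disc, or a common closed string. -/
inductive Touch {ι : Type} {col : ι → Colour} {out : Colour} {R L : Type}
    (regOut : Fin (2 * out.1 + 1) → R) (regIn : (i : ι) → Fin (2 * (col i).1 + 1) → R)
    (loopSide : L → Bool → R) : R → R → Prop
  | outer (j k : Fin (2 * out.1 + 1)) : Touch regOut regIn loopSide (regOut j) (regOut k)
  | inner (i : ι) (j k : Fin (2 * (col i).1 + 1)) :
      Touch regOut regIn loopSide (regIn i j) (regIn i k)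
  | loop (l : L) (a b : Bool) : Touch regOut regIn loopSide (loopSide l a) (loopSide l b)

/-- Two discs are linked if a string runs from one to the other. -/
def Linked {ι : Type} {col : ι → Colour} {out : Colour} (mate : Point col out → Point col out)
    (d e : Option ι) : Prop :=
  ∃ p : Point col out, p.disc = d ∧ (mate p).disc = e

end PlanarTangle

open PlanarTangle in
/-- A shaded planar tangle, up to isotopy, with input discs of colours `col i` and output disc of
colour `out`. -/
structure PlanarTangle {ι : Type} (col : ι → Colour) (out : Colour) where
  /-- the connected components of the complement of the discs and strings -/
  Region : Type
  /-- the closed strings, i.e. those that do not meet a disc -/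
  Loop : Type
  finite_input : Finite ι
  finite_region : Finite Region
  finite_loop : Finite Loop
  /-- Interval `j` of a disc lies just before point `j` (clockwise) and just after point `j - 1`;
  the intervals `0` and `2 * n` are the two ends of the `$`-interval. -/
  regOut : Fin (2 * out.1 + 1) → Region
  regIn : (i : ι) → Fin (2 * (col i).1 + 1) → Region
  /-- the shading: `true` is shaded -/
  shade : Region → Bool
  /-- the region on the unshaded (`false`) and on the shaded (`true`) side of a closed string -/
  loopSide : Loop → Bool → Region
  /-- the other end of the string that starts at a marked point -/
  mate : Point col out → Point col out
  mate_mate : ∀ p, mate (mate p) = p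
  mate_ne : ∀ p, mate p ≠ p
  regOut_last : regOut (Fin.last _) = regOut 0
  regIn_last : ∀ i, regIn i (Fin.last _) = regIn i 0
  shade_regOut : ∀ j, shade (regOut j) = alternate out.2 j
  shade_regIn : ∀ i j, shade (regIn i j) = alternate (col i).2 j
  shade_loopSide : ∀ l b, shade (loopSide l b) = b
  /-- Both sides of a string whose two ends lie on input discs, or both on the output disc. -/
  side_same : ∀ p, p.isLeft = (mate p).isLeft →
    before regOut regIn p = after regOut regIn (mate p)
  /-- Both sides of a string between an input disc and the output disc. -/
  side_diff : ∀ p, p.isLeft ≠ (mate p).isLeft →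
    before regOut regIn p = before regOut regIn (mate p) ∧
    after regOut regIn p = after regOut regIn (mate p)
  connected : ∀ r, Relation.ReflTransGen (Touch regOut regIn loopSide) (regOut 0) r
  /-- Twice Euler's formula `V - E + F = 1 + C` for the planar graph whose vertices are the discs
  (the output disc included), with one more vertex on every closed string, whose edges are the
  strings and whose faces are the regions. The closed strings contribute equally to `V` and `E`,
  and each of them is a connected component. -/
  euler : 2 * (Nat.card (Option ι) + Nat.card Region) =
    Nat.card (Point col out) + 2 * (1 + (Nat.card (Quot (Linked mate)) + Nat.card Loop))

namespace PlanarTangle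

variable {ι : Type} {col : ι → Colour} {out : Colour}

/-! ### Isotopy, gluing and reflection -/

/-- `T'` is the tangle `T` with its input discs renumbered along `e`. -/
def IsRelabelling {ι' : Type} (e : ι' ≃ ι) (T : PlanarTangle col out)
    (T' : PlanarTangle (fun i => col (e i)) out) : Prop :=
  ∃ (f : T'.Region ≃ T.Region) (g : T'.Loop ≃ T.Loop),
    (∀ j, f (T'.regOut j) = T.regOut j) ∧
    (∀ i j, f (T'.regIn i j) = T.regIn (e i) j) ∧
    (∀ r, T.shade (f r) = T'.shade r) ∧
    (∀ l b, T.loopSide (g l) b = f (T'.loopSide l b)) ∧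
    ∀ p, T.mate (Sum.map id (fun x : Σ i, Fin (2 * (col (e i)).1) => ⟨e x.1, x.2⟩) p) =
      Sum.map id (fun x : Σ i, Fin (2 * (col (e i)).1) => ⟨e x.1, x.2⟩) (T'.mate p)

section Gluing

variable {κ : ι → Type} {c : (i : ι) → κ i → Colour}

/-- The marked points seen when tangles are glued into the input discs of another tangle: those on
the output disc, those on the glued circles, those on the innermost discs. -/
abbrev GluePoint (col : ι → Colour) (out : Colour) (c : (i : ι) → κ i → Colour) : Type :=
  Fin (2 * out.1) ⊕ (Σ i : ι, Fin (2 * (col i).1)) ⊕ (Σ i : ι, Σ k : κ i, Fin (2 * (c i k).1))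

/-- The points of the surrounding tangle among the points of the glued picture. -/
def ofOuter (c : (i : ι) → κ i → Colour) : Point col out → GluePoint col out c
  | Sum.inl p => Sum.inl p
  | Sum.inr x => Sum.inr (Sum.inl x)

/-- The points of the `i`-th inserted tangle among the points of the glued picture. -/
def ofInner (out : Colour) (c : (i : ι) → κ i → Colour) (i : ι) :
    Point (c i) (col i) → GluePoint col out c
  | Sum.inl p => Sum.inr (Sum.inl ⟨i, p⟩)
  | Sum.inr x => Sum.inr (Sum.inr ⟨i, x⟩)

/-- The points of the composite tangle among the points of the glued picture. -/
def ofComposite (col : ι → Colour) (out : Colour) (c : (i : ι) → κ i → Colour) :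
    Point (fun x : Σ i, κ i => c x.1 x.2) out → GluePoint col out c
  | Sum.inl p => Sum.inl p
  | Sum.inr x => Sum.inr (Sum.inr ⟨x.1.1, x.1.2, x.2⟩)

/-- Points of the glued picture that are the two ends of a string of one of the tangles. -/
inductive Joined (T : PlanarTangle col out) (S : (i : ι) → PlanarTangle (c i) (col i)) :
    GluePoint col out c → GluePoint col out c → Prop
  | outer (p : Point col out) : Joined T S (ofOuter c p) (ofOuter c (T.mate p))
  | inner (i : ι) (p : Point (c i) (col i)) :
      Joined T S (ofInner out c i p) (ofInner out c i ((S i).mate p))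

/-- The strings of the glued picture. -/
abbrev Strand (T : PlanarTangle col out) (S : (i : ι) → PlanarTangle (c i) (col i)) : Type :=
  Quot (Joined T S)

/-- The strings of the glued picture that cross glued circles but have no end point. -/
abbrev ClosedStrand (T : PlanarTangle col out) (S : (i : ι) → PlanarTangle (c i) (col i)) : Type :=
  {s : Strand T S // ∀ p, Quot.mk _ (ofComposite col out c p) ≠ s}

/-- A region of the surrounding tangle and a region of an inserted tangle that share an interval of
the glued circle. -/
inductive SharesInterval (T : PlanarTangle col out)
    (S : (i : ι) → PlanarTangle (c i) (col i)) :
    T.Region ⊕ (Σ i, (S i).Region) → T.Region ⊕ (Σ i, (S i).Region) → Prop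
  | mk (i : ι) (j : Fin (2 * (col i).1 + 1)) :
      SharesInterval T S (Sum.inl (T.regIn i j)) (Sum.inr ⟨i, (S i).regOut j⟩)

/-- `U` is obtained by gluing the tangles `S i` into the input discs of `T` and then erasing the
glued circles. -/
def IsComposite (T : PlanarTangle col out) (S : (i : ι) → PlanarTangle (c i) (col i))
    (U : PlanarTangle (fun x : Σ i, κ i => c x.1 x.2) out) : Prop :=
  ∃ (f : Quot (SharesInterval T S) ≃ U.Region)
    (g : T.Loop ⊕ (Σ i, (S i).Loop) ⊕ ClosedStrand T S ≃ U.Loop),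
    (∀ r, U.shade (f (Quot.mk _ (Sum.inl r))) = T.shade r) ∧
    (∀ i r, U.shade (f (Quot.mk _ (Sum.inr ⟨i, r⟩))) = (S i).shade r) ∧
    (∀ j, U.regOut j = f (Quot.mk _ (Sum.inl (T.regOut j)))) ∧
    (∀ x j, U.regIn x j = f (Quot.mk _ (Sum.inr ⟨x.1, (S x.1).regIn x.2 j⟩))) ∧
    (∀ p, (Quot.mk _ (ofComposite col out c (U.mate p)) : Strand T S) =
      Quot.mk _ (ofComposite col out c p)) ∧
    (∀ l b, U.loopSide (g (Sum.inl l)) b = f (Quot.mk _ (Sum.inl (T.loopSide l b)))) ∧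
    (∀ i l b, U.loopSide (g (Sum.inr (Sum.inl ⟨i, l⟩))) b =
      f (Quot.mk _ (Sum.inr ⟨i, (S i).loopSide l b⟩))) ∧
    (∀ (s : ClosedStrand T S) (i : ι) (p : Fin (2 * (col i).1)),
      Quot.mk _ (Sum.inr (Sum.inl ⟨i, p⟩)) = s.1 →
      U.loopSide (g (Sum.inr (Sum.inr s))) (T.shade (T.regIn i p.castSucc)) =
        f (Quot.mk _ (Sum.inl (T.regIn i p.castSucc))) ∧
      U.loopSide (g (Sum.inr (Sum.inr s))) (T.shade (T.regIn i p.succ)) =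
        f (Quot.mk _ (Sum.inl (T.regIn i p.succ))))

end Gluing

/-- The reflection of the marked points in a line through the `$`-intervals. -/
def flip : Point col out → Point col out :=
  Sum.map Fin.rev (fun x => ⟨x.1, x.2.rev⟩)

theorem flip_flip (p : Point col out) : flip (flip p) = p := by
  rcases p with p | ⟨i, p⟩ <;> simp [flip]

theorem disc_flip (p : Point col out) : (flip p).disc = p.disc := by
  rcases p with p | ⟨i, p⟩ <;> rfl

theorem isLeft_flip (p : Point col out) : (flip p).isLeft = p.isLeft := by
  rcases p with p | ⟨i, p⟩ <;> rfl

theorem before_flip {R : Type} (a : Fin (2 * out.1 + 1) → R)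
    (b : (i : ι) → Fin (2 * (col i).1 + 1) → R) (p : Point col out) :
    before (fun j => a j.rev) (fun i j => b i j.rev) p = after a b (flip p) := by
  rcases p with p | ⟨i, p⟩ <;> simp [before, after, flip, Fin.rev_castSucc]

theorem after_flip {R : Type} (a : Fin (2 * out.1 + 1) → R)
    (b : (i : ι) → Fin (2 * (col i).1 + 1) → R) (p : Point col out) :
    after (fun j => a j.rev) (fun i j => b i j.rev) p = before a b (flip p) := by
  rcases p with p | ⟨i, p⟩ <;> simp [before, after, flip, Fin.rev_succ]

theorem alternate_rev (s : Bool) (n : ℕ) (j : Fin (2 * n + 1)) :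
    alternate s j.rev = alternate s j := by
  have h : (j.rev : ℕ) % 2 = (j : ℕ) % 2 := by
    have := j.isLt
    rw [Fin.val_rev]
    omega
  simp only [alternate, h]

/-- The mirror image of a tangle. -/
def reflect (T : PlanarTangle col out) : PlanarTangle col out where
  Region := T.Region
  Loop := T.Loop
  finite_input := T.finite_input
  finite_region := T.finite_region
  finite_loop := T.finite_loop
  regOut j := T.regOut j.rev
  regIn i j := T.regIn i j.rev
  shade := T.shade
  loopSide := T.loopSide
  mate p := flip (T.mate (flip p))
  mate_mate p := by simp [flip_flip, T.mate_mate]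
  mate_ne p h := T.mate_ne (flip p) (by rw [← flip_flip (T.mate (flip p)), h])
  regOut_last := by simpa using T.regOut_last.symm
  regIn_last i := by simpa using (T.regIn_last i).symm
  shade_regOut j := by rw [T.shade_regOut, alternate_rev]
  shade_regIn i j := by rw [T.shade_regIn, alternate_rev]
  shade_loopSide := T.shade_loopSide
  side_same p h := by
    rw [before_flip, after_flip, flip_flip]
    have h1 : (T.mate (flip p)).isLeft = (T.mate (T.mate (flip p))).isLeft := by
      rw [T.mate_mate, isLeft_flip, h, isLeft_flip]
    have := T.side_same _ h1
    rw [T.mate_mate] at this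
    exact this.symm
  side_diff p h := by
    rw [before_flip, after_flip, before_flip, after_flip, flip_flip]
    have h1 : (flip p).isLeft ≠ (T.mate (flip p)).isLeft := by
      rw [isLeft_flip]
      rwa [isLeft_flip] at h
    exact ⟨(T.side_diff _ h1).2, (T.side_diff _ h1).1⟩
  connected r := by
    have h0 : T.regOut (Fin.rev 0) = T.regOut 0 := by simpa using T.regOut_last
    rw [h0]
    refine Relation.ReflTransGen.mono (r := Touch T.regOut T.regIn T.loopSide)
      (fun a b hab => ?_) _ _ (T.connected r)
    cases hab with
    | outer j k =>
      simpa using Touch.outer (regOut := fun j => T.regOut j.rev)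
        (regIn := fun i j => T.regIn i j.rev) (loopSide := T.loopSide) j.rev k.rev
    | inner i j k =>
      simpa using Touch.inner (regOut := fun j => T.regOut j.rev)
        (regIn := fun i j => T.regIn i j.rev) (loopSide := T.loopSide) i j.rev k.rev
    | loop l a b => exact Touch.loop l a b
  euler := by
    have h : Linked (fun p => flip (T.mate (flip p))) = Linked T.mate := by
      funext d e
      apply propext
      constructor
      · rintro ⟨p, h1, h2⟩
        exact ⟨flip p, by rw [disc_flip, h1], by rwa [disc_flip] at h2⟩
      · rintro ⟨p, h1, h2⟩
        exact ⟨flip p, by rw [disc_flip, h1], by simp only [flip_flip, disc_flip, h2]⟩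
    rw [h]
    exact T.euler

/-! ### The tangles of the basic operations

A disc of colour `(n, s)` is drawn as a rectangle with `$` on the left: the points `0, …, n - 1` are
on its top from left to right, the points `n, …, 2 * n - 1` on its bottom from right to left. -/

/-- Column `min j (2 * n - j)`, counted from the left, of the interval `j`. -/
def column (n j : ℕ) : Fin (n + 1) := ⟨min j (2 * n - j), by omega⟩

theorem card_quot_linked_eq_one {mate : Point col out → Point col out}
    (h : ∀ i, Quot.mk (Linked mate) (some i) = Quot.mk (Linked mate) none) :
    Nat.card (Quot (Linked mate)) = 1 := by
  rw [Nat.card_eq_one_iff_unique]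
  refine ⟨⟨fun a b => ?_⟩, ⟨Quot.mk _ none⟩⟩
  have key : ∀ d : Option ι, Quot.mk (Linked mate) d = Quot.mk (Linked mate) none := by
    rintro (_ | i)
    · rfl
    · exact h i
  induction a using Quot.ind
  induction b using Quot.ind
  exact (key _).trans (key _).symm

theorem touch_of_eq {R L : Type} {a : Fin (2 * out.1 + 1) → R}
    {b : (i : ι) → Fin (2 * (col i).1 + 1) → R} {l : L → Bool → R} {r r' t t' : R}
    (h : Touch a b l r r') (hr : r = t) (hr' : r' = t') : Touch a b l t t' :=
  hr ▸ hr' ▸ h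

theorem card_quot_linked_eq_card {mate : Point col out → Point col out}
    (h : ∀ p, p.disc = (mate p).disc) :
    Nat.card (Quot (Linked mate)) = Nat.card (Option ι) := by
  refine Nat.card_congr ⟨Quot.lift id ?_, Quot.mk _, ?_, fun _ => rfl⟩
  · rintro d e ⟨p, h1, h2⟩
    exact h1.symm.trans ((h p).trans h2)
  · intro q
    induction q using Quot.ind
    rfl

/-- The identity tangle: `2 * n` radial strings. -/
def identity (c : Colour) : PlanarTangle (fun _ : Unit => c) c where
  Region := Fin (2 * c.1 - 1 + 1)
  Loop := Empty
  finite_input := inferInstance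
  finite_region := inferInstance
  finite_loop := inferInstance
  regOut j := if h : (j : ℕ) < 2 * c.1 then ⟨j, by omega⟩ else 0
  regIn _ j := if h : (j : ℕ) < 2 * c.1 then ⟨j, by omega⟩ else 0
  shade r := alternate c.2 r
  loopSide l := l.elim
  mate := fun
    | Sum.inl p => Sum.inr ⟨(), p⟩
    | Sum.inr x => Sum.inl x.2
  mate_mate := by rintro (p | ⟨_, p⟩) <;> rfl
  mate_ne := by rintro (p | ⟨_, p⟩) <;> simp
  regOut_last := by ext; by_cases h : 0 < c.1 <;> simp [h]
  regIn_last _ := by ext; by_cases h : 0 < c.1 <;> simp [h]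
  shade_regOut j := by
    have := j.isLt
    by_cases h : (j : ℕ) < 2 * c.1
    · simp [h]
    · have hj : (j : ℕ) = 2 * c.1 := by omega
      simp [hj, alternate]
  shade_regIn _ j := by
    have := j.isLt
    by_cases h : (j : ℕ) < 2 * c.1
    · simp [h]
    · have hj : (j : ℕ) = 2 * c.1 := by omega
      simp [hj, alternate]
  shade_loopSide l := l.elim
  side_same := by rintro (p | ⟨_, p⟩) <;> simp
  side_diff := by rintro (p | ⟨_, p⟩) <;> simp [before, after]
  connected r := by
    refine Relation.ReflTransGen.single ?_
    have hr := r.isLt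
    have h := Touch.outer (ι := Unit) (col := fun _ => c)
      (regOut := fun j : Fin (2 * c.1 + 1) =>
        if h : (j : ℕ) < 2 * c.1 then (⟨j, by omega⟩ : Fin (2 * c.1 - 1 + 1)) else 0)
      (regIn := fun _ (j : Fin (2 * c.1 + 1)) =>
        if h : (j : ℕ) < 2 * c.1 then (⟨j, by omega⟩ : Fin (2 * c.1 - 1 + 1)) else 0)
      (loopSide := fun l : Empty => l.elim) 0 ⟨r, by omega⟩
    convert h using 1
    by_cases h2 : (r : ℕ) < 2 * c.1
    · simp [h2]
    · ext
      simp
      omega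
  euler := by
    rcases c with ⟨n, s⟩
    rcases Nat.eq_zero_or_pos n with rfl | hn
    · rw [card_quot_linked_eq_card (fun p => by rcases p with p | ⟨_, p⟩ <;> exact p.elim0)]
      simp
    · rw [card_quot_linked_eq_one]
      · simp
        omega
      · rintro ⟨⟩
        exact (Quot.sound ⟨Sum.inl ⟨0, by simpa using hn⟩, rfl, rfl⟩).symm

/-- The tangle of the unit of `P_{n,±}`: `n` vertical strings. -/
def unit (c : Colour) : PlanarTangle (fun i : Empty => i.elim) c where
  Region := Fin (c.1 + 1)
  Loop := Empty
  finite_input := inferInstance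
  finite_region := inferInstance
  finite_loop := inferInstance
  regOut j := column c.1 j
  regIn i := i.elim
  shade r := alternate c.2 r
  loopSide l := l.elim
  mate := fun
    | Sum.inl p => Sum.inl p.rev
    | Sum.inr x => x.1.elim
  mate_mate := by rintro (p | ⟨⟨⟩, p⟩); simp
  mate_ne := by
    rintro (p | ⟨⟨⟩, p⟩) h
    have h1 := congrArg Fin.val (Sum.inl.inj h)
    rw [Fin.val_rev] at h1
    omega
  regOut_last := by simp [column]
  regIn_last i := i.elim
  shade_regOut j := by
    have := j.isLt
    have h : min (j : ℕ) (2 * c.1 - j) % 2 = (j : ℕ) % 2 := by omega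
    simp only [column, alternate, h]
  shade_regIn i := i.elim
  shade_loopSide l := l.elim
  side_same := by
    rintro (p | ⟨⟨⟩, p⟩) _
    have := p.isLt
    simp only [before, after, column, Fin.ext_iff, Fin.val_castSucc, Fin.val_succ, Fin.val_rev]
    omega
  side_diff := by
    rintro (p | ⟨⟨⟩, p⟩) h
    exact absurd rfl h
  connected r := by
    refine Relation.ReflTransGen.single ?_
    have hr := r.isLt
    have h := Touch.outer (ι := Empty) (col := fun i => i.elim) (out := c)
      (regOut := fun j => column c.1 j) (regIn := fun i => i.elim)
      (loopSide := fun l : Empty => l.elim) 0 ⟨r, by omega⟩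
    convert h using 1
    ext
    simp [column]
    omega
  euler := by
    rw [card_quot_linked_eq_one (fun i => i.elim)]
    simp
    omega

/-- The tangle of the right closure `P_{n,±} → P_{0,±}`, which defines the trace. -/
def closure (c : Colour) : PlanarTangle (fun _ : Unit => c) (0, c.2) where
  Region := Fin (c.1 + 1)
  Loop := Empty
  finite_input := inferInstance
  finite_region := inferInstance
  finite_loop := inferInstance
  regOut _ := 0
  regIn _ j := column c.1 j
  shade r := alternate c.2 r
  loopSide l := l.elim
  mate := fun
    | Sum.inl p => p.elim0
    | Sum.inr x => Sum.inr ⟨(), x.2.rev⟩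
  mate_mate := by
    rintro (p | ⟨_, p⟩)
    · exact p.elim0
    · simp
  mate_ne := by
    rintro (p | ⟨_, p⟩) h
    · exact p.elim0
    · have h1 : p.rev = p := by simpa using h
      have h2 := congrArg Fin.val h1
      rw [Fin.val_rev] at h2
      omega
  regOut_last := rfl
  regIn_last i := by simp [column]
  shade_regOut j := by
    have h : (j : ℕ) = 0 := by
      have := j.isLt
      omega
    rw [h]
    rfl
  shade_regIn _ j := by
    have := j.isLt
    have h : min (j : ℕ) (2 * c.1 - j) % 2 = (j : ℕ) % 2 := by omega
    simp only [column, alternate, h]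
  shade_loopSide l := l.elim
  side_same := by
    rintro (p | ⟨_, p⟩) _
    · exact p.elim0
    · have : (p : ℕ) < 2 * c.1 := p.isLt
      simp only [before, after, column, Fin.ext_iff, Fin.val_castSucc, Fin.val_succ, Fin.val_rev]
      omega
  side_diff := by
    rintro (p | ⟨_, p⟩) h
    · exact p.elim0
    · exact absurd rfl h
  connected r := by
    refine Relation.ReflTransGen.single ?_
    have hr := r.isLt
    have h := Touch.inner (ι := Unit) (col := fun _ => c) (out := (0, c.2))
      (regOut := fun _ => (0 : Fin (c.1 + 1))) (regIn := fun _ j => column c.1 j)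
      (loopSide := fun l : Empty => l.elim) () 0 ⟨r, by omega⟩
    convert h using 1
    · ext
      simp [column]
    · ext
      simp [column]
      omega
  euler := by
    rw [card_quot_linked_eq_card]
    · simp
      omega
    · rintro (p | ⟨_, p⟩)
      · exact p.elim0
      · rfl

/-- The region in column `k` of the multiplication tangle, at height `0` (top), `1` (between the
two discs) or `2` (bottom); the leftmost and the rightmost column are one region each. -/
def mulRegion (n : ℕ) (k : Fin (n + 1)) (height : ℕ) : Fin (n + 1) ⊕ Fin (n - 1) ⊕ Fin (n - 1) :=
  if h : 0 < height ∧ 0 < (k : ℕ) ∧ (k : ℕ) < n then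
    if height = 1 then Sum.inr (Sum.inl ⟨k - 1, by omega⟩)
    else Sum.inr (Sum.inr ⟨k - 1, by omega⟩)
  else Sum.inl k

/-- The shading of the regions of the multiplication tangle. -/
def mulShade (c : Colour) : Fin (c.1 + 1) ⊕ Fin (c.1 - 1) ⊕ Fin (c.1 - 1) → Bool
  | Sum.inl k => alternate c.2 k
  | Sum.inr (Sum.inl k) => alternate c.2 (k + 1)
  | Sum.inr (Sum.inr k) => alternate c.2 (k + 1)

theorem shade_mulRegion (c : Colour) (j h : ℕ) (hj : j < 2 * c.1 + 1) :
    mulShade c (mulRegion c.1 (column c.1 j) h) = alternate c.2 j := by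
  have h1 : min j (2 * c.1 - j) % 2 = j % 2 := by omega
  unfold mulRegion
  split_ifs with h2 h3
  · have h4 : (min j (2 * c.1 - j) - 1 + 1) % 2 = j % 2 := by
      have : 0 < min j (2 * c.1 - j) := h2.2.1
      omega
    simp only [mulShade, column, alternate, h4]
  · have h4 : (min j (2 * c.1 - j) - 1 + 1) % 2 = j % 2 := by
      have : 0 < min j (2 * c.1 - j) := h2.2.1
      omega
    simp only [mulShade, column, alternate, h4]
  · simp only [mulShade, column, alternate, h1]

theorem mulRegion_congr {n j j' h h' : ℕ} (hj : min j (2 * n - j) = min j' (2 * n - j'))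
    (hh : 0 < min j (2 * n - j) → min j (2 * n - j) < n → h = h') :
    mulRegion n (column n j) h = mulRegion n (column n j') h' := by
  have h1 : column n j = column n j' := Fin.ext hj
  rw [h1]
  by_cases h2 : 0 < (column n j' : ℕ) ∧ (column n j' : ℕ) < n
  · rw [hh (by rw [hj]; exact h2.1) (by rw [hj]; exact h2.2)]
  · unfold mulRegion
    rw [dif_neg (fun h3 => h2 h3.2), dif_neg (fun h3 => h2 h3.2)]

theorem mulRegion_one {n : ℕ} {k : Fin (n + 1)} {i : Fin (n - 1)} (h : (k : ℕ) = i + 1) :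
    mulRegion n k 1 = Sum.inr (Sum.inl i) := by
  have hi := i.isLt
  unfold mulRegion
  rw [dif_pos ⟨by omega, by omega, by omega⟩, if_pos rfl]
  exact congrArg (Sum.inr ∘ Sum.inl) (Fin.ext (by dsimp only; omega))

theorem mulRegion_two {n : ℕ} {k : Fin (n + 1)} {i : Fin (n - 1)} (h : (k : ℕ) = i + 1) :
    mulRegion n k 2 = Sum.inr (Sum.inr i) := by
  have hi := i.isLt
  unfold mulRegion
  rw [dif_pos ⟨by omega, by omega, by omega⟩, if_neg (by omega)]
  exact congrArg (Sum.inr ∘ Sum.inr) (Fin.ext (by dsimp only; omega))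

/-- The multiplication tangle: the input disc `1` stands on top of the input disc `0`. -/
def mul (c : Colour) : PlanarTangle (fun _ : Fin 2 => c) c where
  Region := Fin (c.1 + 1) ⊕ Fin (c.1 - 1) ⊕ Fin (c.1 - 1)
  Loop := Empty
  finite_input := inferInstance
  finite_region := inferInstance
  finite_loop := inferInstance
  regOut j := mulRegion c.1 (column c.1 j) (if (j : ℕ) ≤ c.1 then 0 else 2)
  regIn i j := mulRegion c.1 (column c.1 j)
    (if (j : ℕ) ≤ c.1 then (if i = 1 then 0 else 1) else (if i = 1 then 1 else 2))
  shade := mulShade c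
  loopSide l := l.elim
  mate := fun
    | Sum.inl p => if (p : ℕ) < c.1 then Sum.inr ⟨1, p⟩ else Sum.inr ⟨0, p⟩
    | Sum.inr ⟨0, p⟩ => if (p : ℕ) < c.1 then Sum.inr ⟨1, p.rev⟩ else Sum.inl p
    | Sum.inr ⟨1, p⟩ => if (p : ℕ) < c.1 then Sum.inl p else Sum.inr ⟨0, p.rev⟩
  mate_mate := by
    rintro (p | ⟨i, p⟩)
    · by_cases h : (p : ℕ) < c.1 <;> simp [h]
    · have hp : (p : ℕ) < 2 * c.1 := p.isLt
      have hr : (p.rev : ℕ) = 2 * c.1 - (p + 1) := Fin.val_rev p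
      fin_cases i <;> by_cases h : (p : ℕ) < c.1
      · simp [h]
        omega
      · simp [h]
      · simp [h]
      · simp [h]
        omega
  mate_ne := by
    rintro (p | ⟨i, p⟩)
    · by_cases h : (p : ℕ) < c.1 <;> simp [h]
    · fin_cases i <;> by_cases h : (p : ℕ) < c.1 <;> simp [h]
  regOut_last := by simp [mulRegion, column]
  regIn_last i := by simp [mulRegion, column]
  shade_regOut j := by
    have hj : (j : ℕ) < 2 * c.1 + 1 := j.isLt
    exact shade_mulRegion c _ _ hj
  shade_regIn i j := by
    have hj : (j : ℕ) < 2 * c.1 + 1 := j.isLt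
    exact shade_mulRegion c _ _ hj
  shade_loopSide l := l.elim
  side_same := by
    rintro (p | ⟨i, p⟩)
    · by_cases h : (p : ℕ) < c.1 <;> simp [h]
    · have hp : (p : ℕ) < 2 * c.1 := p.isLt
      have hr : (p.rev : ℕ) = 2 * c.1 - (p + 1) := Fin.val_rev p
      fin_cases i <;> by_cases h : (p : ℕ) < c.1 <;> simp [h, before, after]
      all_goals exact mulRegion_congr (by omega) (by intros; split_ifs <;> omega)
  side_diff := by
    rintro (p | ⟨i, p⟩)
    · by_cases h : (p : ℕ) < c.1 <;> simp [h, before, after]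
      all_goals exact mulRegion_congr (by omega) (by intros; split_ifs <;> omega)
    · fin_cases i <;> by_cases h : (p : ℕ) < c.1 <;> simp [h, before, after]
      all_goals exact mulRegion_congr (by omega) (by intros; split_ifs <;> omega)
  connected r := by
    refine Relation.ReflTransGen.single ?_
    rcases r with k | k | k
    · have hk := k.isLt
      refine touch_of_eq (.outer 0 ⟨k, by omega⟩) rfl ?_
      dsimp only
      rw [if_pos (by omega)]
      exact congrArg Sum.inl (Fin.ext (by simp only [column]; omega))
    · have hk := k.isLt
      refine touch_of_eq (.inner 1 0 ⟨2 * c.1 - (k + 1), by exact Nat.lt_succ_of_le (Nat.sub_le _ _)⟩)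
        (by simp [mulRegion]) ?_
      dsimp only
      rw [if_neg (by omega), if_pos rfl]
      exact mulRegion_one (by simp only [column]; omega)
    · have hk := k.isLt
      refine touch_of_eq (.outer 0 ⟨2 * c.1 - (k + 1), by omega⟩) rfl ?_
      dsimp only
      rw [if_neg (by omega)]
      exact mulRegion_two (by simp only [column]; omega)
  euler := by
    rcases c with ⟨n, s⟩
    rcases Nat.eq_zero_or_pos n with rfl | hn
    · rw [card_quot_linked_eq_card (fun p => by rcases p with p | ⟨_, p⟩ <;> exact p.elim0)]
      simp
    · rw [card_quot_linked_eq_one]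
      · simp
        omega
      · have h1 : ∀ i : Fin 2, i = 0 ∨ i = 1 := by decide
        intro i
        refine (Quot.sound ?_).symm
        rcases h1 i with rfl | rfl
        · exact ⟨Sum.inl ⟨n, by dsimp only; omega⟩, rfl, by simp [Point.disc]⟩
        · exact ⟨Sum.inl ⟨0, by dsimp only; omega⟩, rfl, by simp [Point.disc, hn]⟩

/-- The `90°` rotation `P_{2,±} → P_{2,∓}`: the top left point of the output disc is joined to the
bottom left point of the input disc, the top right one to the top left one, and so on. -/
def rotation (s : Bool) : PlanarTangle (fun _ : Unit => ((2, s) : Colour)) (2, !s) where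
  Region := Fin 4
  Loop := Empty
  finite_input := inferInstance
  finite_region := inferInstance
  finite_loop := inferInstance
  regOut := ![3, 0, 1, 2, 3]
  regIn _ := ![0, 1, 2, 3, 0]
  shade := ![s, !s, s, !s]
  loopSide l := l.elim
  mate := fun
    | Sum.inl p => Sum.inr ⟨(), (![3, 0, 1, 2] : Fin 4 → Fin 4) p⟩
    | Sum.inr x => Sum.inl ((![1, 2, 3, 0] : Fin 4 → Fin 4) x.2)
  mate_mate := by
    rintro (p | ⟨i, p⟩)
    · fin_cases p <;> rfl
    · cases i
      fin_cases p <;> rfl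
  mate_ne := by
    rintro (p | ⟨i, p⟩)
    · fin_cases p <;> simp
    · cases i
      fin_cases p <;> simp
  regOut_last := rfl
  regIn_last i := by fin_cases i <;> rfl
  shade_regOut j := by fin_cases j <;> cases s <;> rfl
  shade_regIn _ j := by fin_cases j <;> cases s <;> rfl
  shade_loopSide l := l.elim
  side_same := by
    rintro (p | ⟨i, p⟩) h
    · fin_cases p <;> first | rfl | cases h
    · cases i
      fin_cases p <;> first | rfl | cases h
  side_diff := by
    rintro (p | ⟨i, p⟩) _
    · fin_cases p <;> exact ⟨rfl, rfl⟩
    · cases i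
      fin_cases p <;> exact ⟨rfl, rfl⟩
  connected r := by
    refine Relation.ReflTransGen.single ?_
    fin_cases r
    · exact Touch.outer (out := (2, !s)) (0 : Fin 5) (1 : Fin 5)
    · exact Touch.outer (out := (2, !s)) (0 : Fin 5) (2 : Fin 5)
    · exact Touch.outer (out := (2, !s)) (0 : Fin 5) (3 : Fin 5)
    · exact Touch.outer (out := (2, !s)) (0 : Fin 5) (0 : Fin 5)
  euler := by
    rw [card_quot_linked_eq_one]
    · simp
    · rintro ⟨⟩
      exact (Quot.sound ⟨Sum.inl (0 : Fin 4), rfl, rfl⟩).symm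


/-- The convolution tangle on `P_{2,±}`: the input disc `0` stands to the left of the input disc
`1`. The right points of disc `0` are joined to the left points of disc `1`. The regions are
`0` left, `1` top, `2` right, `3` bottom, `4` between the two discs. -/
def convolution (s : Bool) : PlanarTangle (fun _ : Fin 2 => ((2, s) : Colour)) (2, s) where
  Region := Fin 5
  Loop := Empty
  finite_input := inferInstance
  finite_region := inferInstance
  finite_loop := inferInstance
  regOut := ![0, 1, 2, 3, 0]
  regIn := ![![0, 1, 4, 3, 0], ![4, 1, 2, 3, 4]]
  shade := ![s, !s, s, !s, s]
  loopSide l := l.elim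
  mate := fun
    | Sum.inl p => (![Sum.inr ⟨0, 0⟩, Sum.inr ⟨1, 1⟩, Sum.inr ⟨1, 2⟩, Sum.inr ⟨0, 3⟩] :
        Fin 4 → Fin 4 ⊕ (Σ _ : Fin 2, Fin 4)) p
    | Sum.inr ⟨0, p⟩ => (![Sum.inl 0, Sum.inr ⟨1, 0⟩, Sum.inr ⟨1, 3⟩, Sum.inl 3] :
        Fin 4 → Fin 4 ⊕ (Σ _ : Fin 2, Fin 4)) p
    | Sum.inr ⟨1, p⟩ => (![Sum.inr ⟨0, 1⟩, Sum.inl 1, Sum.inl 2, Sum.inr ⟨0, 2⟩] :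
        Fin 4 → Fin 4 ⊕ (Σ _ : Fin 2, Fin 4)) p
  mate_mate := by
    rintro (p | ⟨i, p⟩)
    · fin_cases p <;> rfl
    · fin_cases i <;> fin_cases p <;> rfl
  mate_ne := by
    rintro (p | ⟨i, p⟩)
    · fin_cases p <;> simp
    · fin_cases i <;> fin_cases p <;> simp
  regOut_last := rfl
  regIn_last i := by fin_cases i <;> rfl
  shade_regOut j := by fin_cases j <;> cases s <;> rfl
  shade_regIn i j := by fin_cases i <;> fin_cases j <;> cases s <;> rfl
  shade_loopSide l := l.elim
  side_same := by
    rintro (p | ⟨i, p⟩) h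
    · fin_cases p <;> first | rfl | cases h
    · fin_cases i <;> fin_cases p <;> first | rfl | cases h
  side_diff := by
    rintro (p | ⟨i, p⟩) h
    · fin_cases p <;> exact ⟨rfl, rfl⟩
    · fin_cases i <;> fin_cases p <;> first | exact ⟨rfl, rfl⟩ | exact absurd rfl h
  connected r := by
    fin_cases r
    · exact Relation.ReflTransGen.refl
    · exact Relation.ReflTransGen.single (Touch.outer (out := (2, s)) (0 : Fin 5) (1 : Fin 5))
    · exact Relation.ReflTransGen.single (Touch.outer (out := (2, s)) (0 : Fin 5) (2 : Fin 5))
    · exact Relation.ReflTransGen.single (Touch.outer (out := (2, s)) (0 : Fin 5) (3 : Fin 5))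
    · exact Relation.ReflTransGen.single (Touch.inner
        (col := fun _ : Fin 2 => ((2, s) : Colour)) (0 : Fin 2) (0 : Fin 5) (2 : Fin 5))
  euler := by
    rw [card_quot_linked_eq_one]
    · simp
    · intro i
      fin_cases i
      · exact (Quot.sound ⟨Sum.inl (0 : Fin 4), rfl, rfl⟩).symm
      · exact (Quot.sound ⟨Sum.inl (1 : Fin 4), rfl, rfl⟩).symm


end PlanarTangle

open PlanarTangle in
/-- A `C*`-planar algebra: an algebra over the operad of shaded planar tangles whose spaces
`V (n, s)` (that is `P_{n,+}` for `s = false` and `P_{n,-}` for `s = true`) are finite-dimensional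
`C*`-algebras for the multiplication tangles and an involution that is compatible with the
reflection of tangles, together with functionals on `P_{0,±}` which make the closure of `n`-boxes a
positive faithful trace on every `P_{n,±}`. -/
structure CStarPlanarAlgebra where
  V : Colour → Type u
  [cstarAlgebra : ∀ c, CStarAlgebra (V c)]
  finiteDimensional : ∀ c, FiniteDimensional ℂ (V c)
  /-- the multilinear map of a tangle -/
  Z : ∀ {ι : Type} {col : ι → Colour} {out : Colour}, PlanarTangle col out →
    MultilinearMap ℂ (fun i => V (col i)) (V out)
  Z_relabel : ∀ {ι ι' : Type} {col : ι → Colour} {out : Colour} (e : ι' ≃ ι)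
    (T : PlanarTangle col out) (T' : PlanarTangle (fun i => col (e i)) out),
    T.IsRelabelling e T' → ∀ x : (i : ι) → V (col i), Z T' (fun i => x (e i)) = Z T x
  Z_identity : ∀ (c : Colour) (x : V c), Z (PlanarTangle.identity c) (fun _ => x) = x
  Z_composite : ∀ {ι : Type} {col : ι → Colour} {out : Colour} {κ : ι → Type}
    {c : (i : ι) → κ i → Colour} (T : PlanarTangle col out)
    (S : (i : ι) → PlanarTangle (c i) (col i))
    (U : PlanarTangle (fun x : Σ i, κ i => c x.1 x.2) out), T.IsComposite S U →
    ∀ x : (y : Σ i, κ i) → V (c y.1 y.2), Z U x = Z T (fun i => Z (S i) (fun k => x ⟨i, k⟩))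
  Z_star : ∀ {ι : Type} {col : ι → Colour} {out : Colour} (T : PlanarTangle col out)
    (x : (i : ι) → V (col i)), star (Z T x) = Z T.reflect (fun i => star (x i))
  mul_eq : ∀ (c : Colour) (x y : V c), x * y = Z (PlanarTangle.mul c) ![x, y]
  one_eq : ∀ c : Colour, (1 : V c) = Z (PlanarTangle.unit c) (fun i => i.elim)
  /-- the functionals `tr_{0,±}` -/
  trZero : ∀ s : Bool, V (0, s) →ₗ[ℂ] ℂ
  /-- positivity and faithfulness of `tr_{n,±}` -/
  trace_pos : ∀ (c : Colour) (x : V c), x ≠ 0 →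
    ∃ t : ℝ, 0 < t ∧ trZero c.2 (Z (PlanarTangle.closure c) (fun _ => star x * x)) = t

namespace CStarPlanarAlgebra

attribute [instance] CStarPlanarAlgebra.cstarAlgebra

/-- The Fourier transform `P_{2,±} → P_{2,∓}`, the `90°` rotation. -/
noncomputable def fourier (P : CStarPlanarAlgebra) {s : Bool} (x : P.V (2, s)) : P.V (2, !s) :=
  P.Z (PlanarTangle.rotation s) (fun _ => x)

/-- The convolution `x ∗ y` on `P_{2,±}`. -/
noncomputable def conv (P : CStarPlanarAlgebra) {s : Bool} (x y : P.V (2, s)) : P.V (2, s) :=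
  P.Z (PlanarTangle.convolution s) ![x, y]

/-- An element of `P_{2,±}` is `𝔉`-positive if its Fourier transform is a positive element of the
`C*`-algebra `P_{2,∓}`. -/
def FPositive (P : CStarPlanarAlgebra) {s : Bool} (x : P.V (2, s)) : Prop :=
  ∃ y : P.V (2, !s), P.fourier x = y * star y

end CStarPlanarAlgebra

/-! This is a Perron–Frobenius argument for the cone `K` of `𝔉`-positive elements of `P_{2,±}`. The
cone is closed, and it is stable under sums and under nonnegative real multiples. The functional `Re
tr (𝔉 a)` is strictly positive on `K` away from `0`, because `tr` is positive and faithful.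

The essential point is that `K` is stable under products. Since `𝔉 (x * y) = 𝔉 x ∗ 𝔉 y`
(`fourier_mul`), this is the Schur product theorem `exists_conv_eq_mul_star`: the convolution `h` of
two positive elements is positive. To see this, write `h⁻ = k * star k`. The closed diagram of `h *
(k * star k)` can be cut into a 3-box and its mirror image (`tr_conv_mul`), so `tr (h * h⁻) ≥ 0`.
But `h * h⁻ = -(h⁻)²`, and faithfulness of the trace forces `h⁻ = 0`.

Given such a cone, let `r` be the spectral radius of `x ≠ 0` and put `S t = ∑ t⁻ⁿ xⁿ⁺¹` for `t > r`
(`exists_eigenvector_mem_cone`). Then `S t` lies in `K` and `x * S t = t • S t - t • x`. By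
compactness the positive functional dominates the norm on `K`, so there is no cancellation in the
series. Hence `t / ‖S t‖` is at most a constant times `t - r`. A limit point of `S t / ‖S t‖` as `t
→ r` is a unit vector of `K`, commutes with `x` and has eigenvalue `r`.

The diagrammatic identities say that two gluings produce the same tangle. Each is reduced to a
finite certificate `GlueCert`, whose fields are decidable for the concrete tangles, and `Z_glue`
turns it into an identity of multilinear maps. -/

namespace PlanarTangle

/-! ### Renumbering input discs of one common colour -/

section Flat

variable {ι ι' : Type} {C D out : Colour}

/-- Renumbering of the input discs among the marked points. -/
def pointEquiv (C out : Colour) (e : ι' ≃ ι) :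
    Point (fun _ : ι' => C) out ≃ Point (fun _ : ι => C) out where
  toFun := Sum.map id (fun x => ⟨e x.1, x.2⟩)
  invFun := Sum.map id (fun x => ⟨e.symm x.1, x.2⟩)
  left_inv := by rintro (p | ⟨i, p⟩) <;> simp
  right_inv := by rintro (p | ⟨i, p⟩) <;> simp

theorem isLeft_pointEquiv (e : ι' ≃ ι) (p : Point (fun _ : ι' => C) out) :
    (pointEquiv C out e p).isLeft = p.isLeft := by
  rcases p with p | ⟨i, p⟩ <;> rfl

theorem disc_pointEquiv (e : ι' ≃ ι) (p : Point (fun _ : ι' => C) out) :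
    (pointEquiv C out e p).disc = Option.map e p.disc := by
  rcases p with p | ⟨i, p⟩ <;> rfl

theorem before_pointEquiv {R : Type} (a : Fin (2 * out.1 + 1) → R)
    (b : (i : ι) → Fin (2 * C.1 + 1) → R) (e : ι' ≃ ι) (p : Point (fun _ : ι' => C) out) :
    before a (fun i => b (e i)) p = before a b (pointEquiv C out e p) := by
  rcases p with p | ⟨i, p⟩ <;> rfl

theorem after_pointEquiv {R : Type} (a : Fin (2 * out.1 + 1) → R)
    (b : (i : ι) → Fin (2 * C.1 + 1) → R) (e : ι' ≃ ι) (p : Point (fun _ : ι' => C) out) :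
    after a (fun i => b (e i)) p = after a b (pointEquiv C out e p) := by
  rcases p with p | ⟨i, p⟩ <;> rfl

/-- A tangle with its input discs renumbered. -/
def relabel (e : ι' ≃ ι) (T : PlanarTangle (fun _ : ι => C) out) :
    PlanarTangle (fun _ : ι' => C) out where
  Region := T.Region
  Loop := T.Loop
  finite_input := have := T.finite_input; Finite.of_equiv ι e.symm
  finite_region := T.finite_region
  finite_loop := T.finite_loop
  regOut := T.regOut
  regIn i := T.regIn (e i)
  shade := T.shade
  loopSide := T.loopSide
  mate p := (pointEquiv C out e).symm (T.mate (pointEquiv C out e p))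
  mate_mate p := by simp [T.mate_mate]
  mate_ne p h := T.mate_ne _ (((pointEquiv C out e).symm_apply_eq).1 h)
  regOut_last := T.regOut_last
  regIn_last i := T.regIn_last (e i)
  shade_regOut := T.shade_regOut
  shade_regIn i := T.shade_regIn (e i)
  shade_loopSide := T.shade_loopSide
  side_same p h := by
    rw [before_pointEquiv, after_pointEquiv, Equiv.apply_symm_apply]
    refine T.side_same _ ?_
    rwa [← isLeft_pointEquiv e p, ← isLeft_pointEquiv e, Equiv.apply_symm_apply] at h
  side_diff p h := by
    rw [before_pointEquiv, after_pointEquiv, before_pointEquiv, after_pointEquiv,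
      Equiv.apply_symm_apply]
    refine T.side_diff _ ?_
    rwa [← isLeft_pointEquiv e p, ← isLeft_pointEquiv e, Equiv.apply_symm_apply] at h
  connected r := by
    refine Relation.ReflTransGen.mono (r := Touch T.regOut T.regIn T.loopSide)
      (fun a b hab => ?_) _ _ (T.connected r)
    cases hab with
    | outer j k => exact Touch.outer j k
    | inner i j k =>
      exact touch_of_eq (Touch.inner (regIn := fun i => T.regIn (e i)) (e.symm i) j k)
        (by simp) (by simp)
    | loop l a b => exact Touch.loop l a b
  euler := by
    have h1 : Nat.card (Quot (Linked fun p : Point (fun _ : ι' => C) out =>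
        (pointEquiv C out e).symm (T.mate (pointEquiv C out e p)))) =
        Nat.card (Quot (Linked T.mate)) := by
      refine Nat.card_congr (Quot.congr (Equiv.optionCongr e) fun a b => ?_)
      constructor
      · rintro ⟨p, rfl, rfl⟩
        refine ⟨pointEquiv C out e p, disc_pointEquiv e p, ?_⟩
        have := disc_pointEquiv e ((pointEquiv C out e).symm (T.mate (pointEquiv C out e p)))
        rwa [Equiv.apply_symm_apply] at this
      · rintro ⟨p, h1, h2⟩
        obtain ⟨q, rfl⟩ := (pointEquiv C out e).surjective p
        refine ⟨q, (Equiv.optionCongr e).injective ?_, (Equiv.optionCongr e).injective ?_⟩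
        · rw [← h1, disc_pointEquiv]; rfl
        · rw [← h2, Equiv.optionCongr_apply, ← disc_pointEquiv, Equiv.apply_symm_apply]
    rw [h1, Nat.card_congr (pointEquiv C out e), Nat.card_congr (Equiv.optionCongr e)]
    exact T.euler

end Flat

/-! ### Tracing strings through a glued picture -/

section Follow

variable {ι : Type} {col : ι → Colour} {out : Colour} {κ : ι → Type} {c : (i : ι) → κ i → Colour}

/-- Follow a string of a glued picture for `n` steps, starting with a piece in the surrounding
tangle (`true`) or in an inserted tangle (`false`), until it ends. -/
def follow (T : PlanarTangle col out) (S : (i : ι) → PlanarTangle (c i) (col i)) :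
    ℕ → Bool → GluePoint col out c → GluePoint col out c
  | 0, _, x => x
  | n + 1, true, Sum.inl p => follow T S n false (ofOuter c (T.mate (Sum.inl p)))
  | n + 1, true, Sum.inr (Sum.inl q) => follow T S n false (ofOuter c (T.mate (Sum.inr q)))
  | _ + 1, true, Sum.inr (Sum.inr q) => Sum.inr (Sum.inr q)
  | _ + 1, false, Sum.inl p => Sum.inl p
  | n + 1, false, Sum.inr (Sum.inl q) =>
      follow T S n true (ofInner out c q.1 ((S q.1).mate (Sum.inl q.2)))
  | n + 1, false, Sum.inr (Sum.inr q) =>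
      follow T S n true (ofInner out c q.1 ((S q.1).mate (Sum.inr q.2)))

/-- Every step of `follow` runs along one string of `T` or of some `S i`, hence along one `Joined`
relation. Statements about the quotient `Strand T S` thereby become computations with
representatives. -/
theorem mk_follow (T : PlanarTangle col out) (S : (i : ι) → PlanarTangle (c i) (col i)) (n : ℕ)
    (b : Bool) (x : GluePoint col out c) :
    (Quot.mk _ (follow T S n b x) : Strand T S) = Quot.mk _ x := by
  induction n generalizing b x with
  | zero => rfl
  | succ n ih =>
    rcases x with p | q | q <;> cases b
    · rfl
    · exact (ih _ _).trans (Quot.sound (Joined.outer (S := S) (Sum.inl p))).symm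
    · exact (ih _ _).trans (Quot.sound (Joined.inner (T := T) q.1 (Sum.inl q.2))).symm
    · exact (ih _ _).trans (Quot.sound (Joined.outer (S := S) (Sum.inr q))).symm
    · exact (ih _ _).trans (Quot.sound (Joined.inner (T := T) q.1 (Sum.inr q.2))).symm
    · rfl

/-- A point of the glued picture that does not lie on a glued circle. -/
def isEnd : GluePoint col out c → Bool
  | Sum.inr (Sum.inl _) => false
  | _ => true

end Follow

/-! ### Certificates for composites -/

section Glue

variable {ι ι' : Type} {C D out : Colour} {κ : ι → Type}

/-- The points of a composite with renumbered input discs among the points of the glued picture. -/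
def ofFlat (C D out : Colour) (d : ι' → Σ i, κ i) :
    Point (fun _ : ι' => C) out → GluePoint (fun _ : ι => D) out (fun (i : ι) (_ : κ i) => C)
  | Sum.inl p => Sum.inl p
  | Sum.inr x => Sum.inr (Sum.inr ⟨(d x.1).1, (d x.1).2, x.2⟩)

/-- Maps between the regions of the tangles `T`, `S i` and those of a composite `U`. -/
structure GlueMaps (T : PlanarTangle (fun _ : ι => D) out)
    (S : (i : ι) → PlanarTangle (fun _ : κ i => C) D)
    (U : PlanarTangle (fun _ : ι' => C) out) where
  outer : T.Region → U.Region
  inner : (i : ι) → (S i).Region → U.Region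
  inv : U.Region → T.Region ⊕ (Σ i, (S i).Region)

variable {T : PlanarTangle (fun _ : ι => D) out} {S : (i : ι) → PlanarTangle (fun _ : κ i => C) D}
  {U : PlanarTangle (fun _ : ι' => C) out} {d : ι' → Σ i, κ i} {m : GlueMaps T S U}

/-- A certificate that `U` is the composite of `T` with the `S i`, with input discs numbered along
`d`, for tangles without closed strings none of whose regions are merged by the gluing. -/
structure GlueCert (d : ι' → Σ i, κ i) (m : GlueMaps T S U) : Prop where
  bijective : d.Bijective
  glue : ∀ i j, m.inner i ((S i).regOut j) = m.outer (T.regIn i j)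
  inv_outer : ∀ r, m.inv (m.outer r) = Sum.inl r
  inv_inner : ∀ i r, m.inv (m.inner i r) = Sum.inr ⟨i, r⟩ ∨ ∃ j, (S i).regOut j = r
  map_inv : ∀ r, Sum.elim m.outer (fun x => m.inner x.1 x.2) (m.inv r) = r
  shade_outer : ∀ r, U.shade (m.outer r) = T.shade r
  shade_inner : ∀ i r, U.shade (m.inner i r) = (S i).shade r
  regOut : ∀ j, U.regOut j = m.outer (T.regOut j)
  regIn : ∀ a j, U.regIn a j = m.inner (d a).1 ((S (d a).1).regIn (d a).2 j)
  -- Three pieces are enough for the composites below, where a string runs at most through one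
  -- inserted tangle, `T` and another inserted tangle. The first piece lies in `T` exactly when the
  -- starting point is on the output disc.
  mate : ∀ p, follow T S 3 p.isLeft (ofFlat C D out d p) = ofFlat C D out d (U.mate p)
  circle : ∀ q, isEnd (follow T S 3 true (Sum.inr (Sum.inl q))) = true

theorem ofFlat_pointEquiv_symm (e : ι' ≃ Σ i, κ i)
    (p : Point (fun _ : Σ i, κ i => C) out) :
    ofFlat C D out e ((pointEquiv C out e).symm p) =
      ofComposite (fun _ => D) out (fun _ _ => C) p := by
  rcases p with p | ⟨x, p⟩
  · rfl
  · obtain ⟨a, rfl⟩ := e.surjective x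
    change ofFlat C D out e (Sum.inr ⟨e.symm (e a), p⟩) = _
    rw [e.symm_apply_apply]
    rfl

/-- The regions of a certified composite. -/
def GlueCert.regionEquiv (H : GlueCert d m) :
    Quot (SharesInterval T S) ≃ U.Region where
  toFun := Quot.lift (Sum.elim m.outer fun x => m.inner x.1 x.2) (by
    rintro _ _ ⟨i, j⟩
    exact (H.glue i j).symm)
  invFun r := Quot.mk _ (m.inv r)
  left_inv := by
    rintro ⟨r | ⟨i, r⟩⟩
    · exact congrArg _ (H.inv_outer r)
    -- A region of `S i` that meets the glued circle is identified with a region of `T`, and `inv`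
    -- returns the latter as representative.
    · rcases H.inv_inner i r with h1 | ⟨j, rfl⟩
      · exact congrArg _ h1
      · have hs : (Quot.mk _ (Sum.inl (T.regIn i j)) : Quot (SharesInterval T S)) =
            Quot.mk _ (Sum.inr ⟨i, (S i).regOut j⟩) :=
          Quot.sound (SharesInterval.mk (T := T) (S := S) i j)
        refine Eq.trans (congrArg (Quot.mk _) ?_) hs
        change m.inv (m.inner i _) = _
        rw [H.glue, H.inv_outer]
  right_inv := H.map_inv

/-- `IsComposite` numbers the input discs by pairs, so `U` is renumbered along the inverse of `d`.
Its strings are right because `follow` computes `mate` without leaving a class of `Strand`. -/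
theorem GlueCert.isComposite (H : GlueCert d m) [IsEmpty T.Loop]
    [∀ i, IsEmpty (S i).Loop] [IsEmpty U.Loop] :
    T.IsComposite S (U.relabel (Equiv.ofBijective d H.bijective).symm) := by
  have h1 : ∀ p, follow T S 3 p.isLeft (ofComposite (fun _ => D) out (fun _ _ => C) p) =
      ofComposite (fun _ => D) out (fun _ _ => C)
        ((U.relabel (Equiv.ofBijective d H.bijective).symm).mate p) := by
    intro p
    set e := Equiv.ofBijective d H.bijective
    have h2 := H.mate ((pointEquiv C out e).symm p)
    have h3 : ((pointEquiv C out e).symm p).isLeft = p.isLeft := by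
      rcases p with p | ⟨i, p⟩ <;> rfl
    rw [h3] at h2
    refine Eq.trans ?_ (h2.trans ?_)
    · exact congrArg _ (ofFlat_pointEquiv_symm e p).symm
    · exact (congrArg _ ((pointEquiv C out e).symm_apply_apply _).symm).trans
        (ofFlat_pointEquiv_symm e (pointEquiv C out e (U.mate ((pointEquiv C out e).symm p))))
  -- A closed strand would contain a point of a glued circle; by `circle`, following the string from
  -- there reaches an end point in the same class.
  have h2 : IsEmpty (ClosedStrand T S) := by
    refine ⟨?_⟩
    rintro ⟨⟨x⟩, hx⟩
    have key : ∀ y : GluePoint (fun _ : ι => D) out (fun (i : ι) (_ : κ i) => C),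
        isEnd y = true → (Quot.mk _ y : Strand T S) ≠ Quot.mk _ x := by
      rintro (p | q | ⟨i, k, q⟩) hy
      · exact hx (Sum.inl p)
      · cases hy
      · exact hx (Sum.inr ⟨⟨i, k⟩, q⟩)
    rcases x with p | q | q
    · exact key (Sum.inl p) rfl rfl
    · exact key _ (H.circle q) (mk_follow T S 3 true _)
    · exact key (Sum.inr (Sum.inr q)) rfl rfl
  have h3 : IsEmpty (U.relabel (Equiv.ofBijective d H.bijective).symm).Loop :=
    inferInstanceAs (IsEmpty U.Loop)
  have h4 : IsEmpty (T.Loop ⊕ (Σ i, (S i).Loop) ⊕ ClosedStrand T S) :=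
    isEmpty_sum.2 ⟨inferInstance, isEmpty_sum.2 ⟨⟨fun l => isEmptyElim l.2⟩, h2⟩⟩
  refine ⟨H.regionEquiv, Equiv.equivOfIsEmpty _ _, H.shade_outer, H.shade_inner, H.regOut, ?_, ?_,
    fun l => isEmptyElim l, fun i l => isEmptyElim (α := (S i).Loop) l, fun s => isEmptyElim s⟩
  · intro x j
    obtain ⟨a, rfl⟩ := H.bijective.2 x
    have : (Equiv.ofBijective d H.bijective).symm (d a) = a :=
      (Equiv.ofBijective d H.bijective).symm_apply_apply a
    change U.regIn ((Equiv.ofBijective d H.bijective).symm (d a)) j = _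
    rw [this]
    exact H.regIn a j
  · intro p
    rw [← h1, mk_follow]

end Glue

theorem isRelabelling_relabel {ι ι' : Type} {C out : Colour} (e : ι' ≃ ι)
    (T : PlanarTangle (fun _ : ι' => C) out) :
    IsRelabelling (col := fun _ : ι => C) e (T.relabel e.symm) T := by
  refine ⟨Equiv.refl _, Equiv.refl _, fun j => rfl, fun i j => ?_, fun r => rfl, fun l b => rfl,
    fun p => ?_⟩
  · change T.regIn i j = T.regIn (e.symm (e i)) j
    rw [Equiv.symm_apply_apply]
  · change (pointEquiv C out e.symm).symm (T.mate (pointEquiv C out e.symm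
      (pointEquiv C out e p))) = pointEquiv C out e (T.mate p)
    have h : pointEquiv C out e.symm = (pointEquiv C out e).symm := Equiv.ext fun p => rfl
    rw [h, Equiv.symm_apply_apply, Equiv.symm_symm]

end PlanarTangle

-- The bridge from tangles to algebra: `Z_composite` handles the gluing and `Z_relabel` undoes the
-- renumbering.
open PlanarTangle in
theorem CStarPlanarAlgebra.Z_glue (P : CStarPlanarAlgebra.{u}) {ι ι' : Type} {C D out : Colour}
    {κ : ι → Type} {T : PlanarTangle (fun _ : ι => D) out}
    {S : (i : ι) → PlanarTangle (fun _ : κ i => C) D} {U : PlanarTangle (fun _ : ι' => C) out}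
    {d : ι' → Σ i, κ i} {m : GlueMaps T S U} [IsEmpty T.Loop]
    [∀ i, IsEmpty (S i).Loop] [IsEmpty U.Loop] (H : GlueCert d m)
    (x : (Σ i, κ i) → P.V C) :
    P.Z U (fun a => x (d a)) = P.Z T (fun i => P.Z (S i) (fun k => x ⟨i, k⟩)) := by
  rw [← P.Z_composite (c := fun _ _ => C) T S _ H.isComposite x]
  exact P.Z_relabel (col := fun _ => C) (Equiv.ofBijective d H.bijective) _ U
    (isRelabelling_relabel _ U) x

/-! ### The tangles of the argument -/

namespace PlanarTangle

/-- A decidable criterion for connectedness: when each region off the output circle shares an input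
disc with a region of smaller number, strong induction leads back to the output circle. -/
theorem connected_of_lt {m N : ℕ} {col : Fin m → Colour} {out : Colour} {L : Type}
    {a : Fin (2 * out.1 + 1) → Fin N} {b : (i : Fin m) → Fin (2 * (col i).1 + 1) → Fin N}
    {l : L → Bool → Fin N}
    (h : ∀ r, (∃ j, a j = r) ∨ ∃ i j k, b i j < r ∧ b i k = r) (r : Fin N) :
    Relation.ReflTransGen (Touch a b l) (a 0) r := by
  induction r using WellFoundedLT.induction with
  | ind r ih =>
    rcases h r with ⟨j, rfl⟩ | ⟨i, j, k, h1, rfl⟩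
    · exact .single (.outer 0 j)
    · exact (ih _ h1).tail (.inner i j k)

/-- An output disc without marked points is a component by itself, and the linked input discs form
the other one. -/
theorem card_quot_linked_eq_two {m : ℕ} {col : Fin (m + 1) → Colour} {s : Bool}
    {mate : Point col (0, s) → Point col (0, s)}
    (h : ∀ i, Quot.mk (Linked mate) (some i) = Quot.mk (Linked mate) (some 0)) :
    Nat.card (Quot (Linked mate)) = 2 := by
  have h1 : ∀ p : Point col (0, s), p.disc.isSome = true := by
    rintro (p | x)
    · exact p.elim0
    · rfl
  let q : Quot (Linked mate) → Bool := Quot.lift Option.isSome (by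
    rintro _ _ ⟨p, rfl, rfl⟩
    rw [h1, h1])
  have hq : q.Bijective := by
    constructor
    · rintro ⟨_ | i⟩ ⟨_ | j⟩ hij
      · rfl
      · cases hij
      · cases hij
      · exact (h i).trans (h j).symm
    · rintro (_ | _)
      · exact ⟨Quot.mk _ none, rfl⟩
      · exact ⟨Quot.mk _ (some 0), rfl⟩
  rw [Nat.card_congr (Equiv.ofBijective q hq), Nat.card_eq_fintype_card, Fintype.card_bool]

/-- The inverse of the rotation tangle. -/
def rotationInv (s : Bool) : PlanarTangle (fun _ : Unit => ((2, !s) : Colour)) (2, s) where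
  Region := Fin 4
  Loop := Empty
  finite_input := inferInstance
  finite_region := inferInstance
  finite_loop := inferInstance
  regOut := ![0, 1, 2, 3, 0]
  regIn _ := ![3, 0, 1, 2, 3]
  shade := ![s, !s, s, !s]
  loopSide l := l.elim
  mate := fun
    | Sum.inl p => Sum.inr ⟨(), (![1, 2, 3, 0] : Fin 4 → Fin 4) p⟩
    | Sum.inr x => Sum.inl ((![3, 0, 1, 2] : Fin 4 → Fin 4) x.2)
  mate_mate := by cases s <;> decide
  mate_ne := by cases s <;> decide
  regOut_last := by decide +revert
  regIn_last i := by decide +revert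
  shade_regOut j := by decide +revert
  shade_regIn _ j := by decide +revert
  shade_loopSide l := l.elim
  side_same := by cases s <;> decide
  side_diff := by cases s <;> decide
  connected r := by
    refine Relation.ReflTransGen.single ?_
    fin_cases r
    · exact Touch.outer (out := (2, s)) (0 : Fin 5) (0 : Fin 5)
    · exact Touch.outer (out := (2, s)) (0 : Fin 5) (1 : Fin 5)
    · exact Touch.outer (out := (2, s)) (0 : Fin 5) (2 : Fin 5)
    · exact Touch.outer (out := (2, s)) (0 : Fin 5) (3 : Fin 5)
  euler := by
    rw [card_quot_linked_eq_one]
    · simp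
    · rintro ⟨⟩
      exact (Quot.sound ⟨Sum.inl (0 : Fin 4), rfl, rfl⟩).symm

/-- The tangle of `𝔉 (x * y)`. -/
def rotationMul (s : Bool) : PlanarTangle (fun _ : Fin 2 => ((2, s) : Colour)) (2, !s) where
  Region := Fin 5
  Loop := Empty
  finite_input := inferInstance
  finite_region := inferInstance
  finite_loop := inferInstance
  regOut := ![0, 1, 2, 3, 0]
  regIn := ![![1, 4, 3, 0, 1], ![1, 2, 3, 4, 1]]
  shade := ![!s, s, !s, s, !s]
  loopSide l := l.elim
  mate := fun
    | Sum.inl p => (![Sum.inr ⟨0, 3⟩, Sum.inr ⟨1, 0⟩, Sum.inr ⟨1, 1⟩, Sum.inr ⟨0, 2⟩] :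
        Fin 4 → Fin 4 ⊕ (Σ _ : Fin 2, Fin 4)) p
    | Sum.inr ⟨0, p⟩ => (![Sum.inr ⟨1, 3⟩, Sum.inr ⟨1, 2⟩, Sum.inl 3, Sum.inl 0] :
        Fin 4 → Fin 4 ⊕ (Σ _ : Fin 2, Fin 4)) p
    | Sum.inr ⟨1, p⟩ => (![Sum.inl 1, Sum.inl 2, Sum.inr ⟨0, 1⟩, Sum.inr ⟨0, 0⟩] :
        Fin 4 → Fin 4 ⊕ (Σ _ : Fin 2, Fin 4)) p
  mate_mate := by cases s <;> decide
  mate_ne := by cases s <;> decide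
  regOut_last := by decide +revert
  regIn_last i := by decide +revert
  shade_regOut j := by decide +revert
  shade_regIn i j := by decide +revert
  shade_loopSide l := l.elim
  side_same := by cases s <;> decide
  side_diff := by cases s <;> decide
  connected := connected_of_lt (by cases s <;> decide)
  euler := by
    rw [card_quot_linked_eq_one]
    · simp
    · intro i
      fin_cases i
      · exact (Quot.sound ⟨Sum.inl (0 : Fin 4), rfl, rfl⟩).symm
      · exact (Quot.sound ⟨Sum.inl (1 : Fin 4), rfl, rfl⟩).symm
/-- The tangle of `(x₀ * x₁) ∗ (x₂ * x₃)`. -/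
def twoProducts (s : Bool) : PlanarTangle (fun _ : Fin 4 => ((2, s) : Colour)) (2, s) where
  Region := Fin 7
  Loop := Empty
  finite_input := inferInstance
  finite_region := inferInstance
  finite_loop := inferInstance
  regOut := ![0, 1, 2, 3, 0]
  regIn := ![![0, 5, 4, 3, 0],
    ![0, 1, 4, 5, 0],
    ![4, 6, 2, 3, 4],
    ![4, 1, 2, 6, 4]]
  shade := ![s, !s, s, !s, s, !s, !s]
  loopSide l := l.elim
  mate := fun
    | Sum.inl p => (![Sum.inr ⟨1, 0⟩, Sum.inr ⟨3, 1⟩, Sum.inr ⟨2, 2⟩, Sum.inr ⟨0, 3⟩] :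
        Fin 4 → Fin 4 ⊕ (Σ _ : Fin 4, Fin 4)) p
    | Sum.inr ⟨0, p⟩ => (![Sum.inr ⟨1, 3⟩, Sum.inr ⟨1, 2⟩, Sum.inr ⟨2, 3⟩, Sum.inl 3] :
        Fin 4 → Fin 4 ⊕ (Σ _ : Fin 4, Fin 4)) p
    | Sum.inr ⟨1, p⟩ => (![Sum.inl 0, Sum.inr ⟨3, 0⟩, Sum.inr ⟨0, 1⟩, Sum.inr ⟨0, 0⟩] :
        Fin 4 → Fin 4 ⊕ (Σ _ : Fin 4, Fin 4)) p
    | Sum.inr ⟨2, p⟩ => (![Sum.inr ⟨3, 3⟩, Sum.inr ⟨3, 2⟩, Sum.inl 2, Sum.inr ⟨0, 2⟩] :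
        Fin 4 → Fin 4 ⊕ (Σ _ : Fin 4, Fin 4)) p
    | Sum.inr ⟨3, p⟩ => (![Sum.inr ⟨1, 1⟩, Sum.inl 1, Sum.inr ⟨2, 1⟩, Sum.inr ⟨2, 0⟩] :
        Fin 4 → Fin 4 ⊕ (Σ _ : Fin 4, Fin 4)) p
  mate_mate := by cases s <;> decide
  mate_ne := by cases s <;> decide
  regOut_last := by decide +revert
  regIn_last i := by decide +revert
  shade_regOut j := by decide +revert
  shade_regIn i j := by decide +revert
  shade_loopSide l := l.elim
  side_same := by cases s <;> decide
  side_diff := by cases s <;> decide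
  connected := connected_of_lt (by cases s <;> decide)
  euler := by
    rw [card_quot_linked_eq_one]
    · simp
    · intro i
      fin_cases i
      · exact (Quot.sound ⟨Sum.inl (3 : Fin 4), rfl, rfl⟩).symm
      · exact (Quot.sound ⟨Sum.inl (0 : Fin 4), rfl, rfl⟩).symm
      · exact (Quot.sound ⟨Sum.inl (2 : Fin 4), rfl, rfl⟩).symm
      · exact (Quot.sound ⟨Sum.inl (1 : Fin 4), rfl, rfl⟩).symm

/-- The tangle of half of the closure of `(x₀⋆ * x₀) ∗ (x₁⋆ * x₁)` and `x₂ * x₂⋆`, where the right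
bottom string is bent up. -/
def halfConvolution (s : Bool) : PlanarTangle (fun _ : Fin 3 => ((2, s) : Colour)) (3, s) where
  Region := Fin 7
  Loop := Empty
  finite_input := inferInstance
  finite_region := inferInstance
  finite_loop := inferInstance
  regOut := ![0, 1, 2, 3, 4, 5, 0]
  regIn := ![![0, 6, 4, 5, 0],
    ![4, 6, 2, 3, 4],
    ![0, 1, 2, 6, 0]]
  shade := ![s, !s, s, !s, s, !s, !s]
  loopSide l := l.elim
  mate := fun
    | Sum.inl p => (![Sum.inr ⟨2, 0⟩, Sum.inr ⟨2, 1⟩, Sum.inr ⟨1, 2⟩, Sum.inr ⟨1, 3⟩,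
      Sum.inr ⟨0, 2⟩, Sum.inr ⟨0, 3⟩] :
        Fin 6 → Fin 6 ⊕ (Σ _ : Fin 3, Fin 4)) p
    | Sum.inr ⟨0, p⟩ => (![Sum.inr ⟨2, 3⟩, Sum.inr ⟨1, 0⟩, Sum.inl 4, Sum.inl 5] :
        Fin 4 → Fin 6 ⊕ (Σ _ : Fin 3, Fin 4)) p
    | Sum.inr ⟨1, p⟩ => (![Sum.inr ⟨0, 1⟩, Sum.inr ⟨2, 2⟩, Sum.inl 2, Sum.inl 3] :
        Fin 4 → Fin 6 ⊕ (Σ _ : Fin 3, Fin 4)) p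
    | Sum.inr ⟨2, p⟩ => (![Sum.inl 0, Sum.inl 1, Sum.inr ⟨1, 1⟩, Sum.inr ⟨0, 0⟩] :
        Fin 4 → Fin 6 ⊕ (Σ _ : Fin 3, Fin 4)) p
  mate_mate := by cases s <;> decide
  mate_ne := by cases s <;> decide
  regOut_last := by decide +revert
  regIn_last i := by decide +revert
  shade_regOut j := by decide +revert
  shade_regIn i j := by decide +revert
  shade_loopSide l := l.elim
  side_same := by cases s <;> decide
  side_diff := by cases s <;> decide
  connected := connected_of_lt (by cases s <;> decide)
  euler := by
    rw [card_quot_linked_eq_one]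
    · simp
    · intro i
      fin_cases i
      · exact (Quot.sound ⟨Sum.inl (4 : Fin 6), rfl, rfl⟩).symm
      · exact (Quot.sound ⟨Sum.inl (2 : Fin 6), rfl, rfl⟩).symm
      · exact (Quot.sound ⟨Sum.inl (0 : Fin 6), rfl, rfl⟩).symm

/-- The tangle of the closure of `x₀ * x₁` on `P_{2,±}`. -/
def closedProduct (s : Bool) : PlanarTangle (fun _ : Fin 2 => ((2, s) : Colour)) (0, s) where
  Region := Fin 4
  Loop := Empty
  finite_input := inferInstance
  finite_region := inferInstance
  finite_loop := inferInstance
  regOut := ![0]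
  regIn := ![![0, 3, 2, 1, 0],
    ![0, 1, 2, 3, 0]]
  shade := ![s, !s, s, !s]
  loopSide l := l.elim
  mate := fun
    | Sum.inl p => p.elim0
    | Sum.inr ⟨0, p⟩ => (![Sum.inr ⟨1, 3⟩, Sum.inr ⟨1, 2⟩, Sum.inr ⟨1, 1⟩, Sum.inr ⟨1, 0⟩] :
        Fin 4 → Fin 0 ⊕ (Σ _ : Fin 2, Fin 4)) p
    | Sum.inr ⟨1, p⟩ => (![Sum.inr ⟨0, 3⟩, Sum.inr ⟨0, 2⟩, Sum.inr ⟨0, 1⟩, Sum.inr ⟨0, 0⟩] :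
        Fin 4 → Fin 0 ⊕ (Σ _ : Fin 2, Fin 4)) p
  mate_mate := by cases s <;> decide
  mate_ne := by cases s <;> decide
  regOut_last := by decide +revert
  regIn_last i := by decide +revert
  shade_regOut j := by decide +revert
  shade_regIn i j := by decide +revert
  shade_loopSide l := l.elim
  side_same := by cases s <;> decide
  side_diff := by cases s <;> decide
  connected := connected_of_lt (by cases s <;> decide)
  euler := by
    rw [card_quot_linked_eq_two]
    · simp
    · intro i
      fin_cases i
      · rfl
      · exact (Quot.sound ⟨Sum.inr ⟨0, (0 : Fin 4)⟩, rfl, rfl⟩).symm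

/-- The tangle of the closure of `x₀ * x₁` on `P_{3,±}`. -/
def closedProductThree (s : Bool) : PlanarTangle (fun _ : Fin 2 => ((3, s) : Colour)) (0, s) where
  Region := Fin 6
  Loop := Empty
  finite_input := inferInstance
  finite_region := inferInstance
  finite_loop := inferInstance
  regOut := ![0]
  regIn := ![![0, 4, 5, 3, 2, 1, 0],
    ![0, 1, 2, 3, 5, 4, 0]]
  shade := ![s, !s, s, !s, !s, s]
  loopSide l := l.elim
  mate := fun
    | Sum.inl p => p.elim0
    | Sum.inr ⟨0, p⟩ => (![Sum.inr ⟨1, 5⟩, Sum.inr ⟨1, 4⟩, Sum.inr ⟨1, 3⟩, Sum.inr ⟨1, 2⟩,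
      Sum.inr ⟨1, 1⟩, Sum.inr ⟨1, 0⟩] :
        Fin 6 → Fin 0 ⊕ (Σ _ : Fin 2, Fin 6)) p
    | Sum.inr ⟨1, p⟩ => (![Sum.inr ⟨0, 5⟩, Sum.inr ⟨0, 4⟩, Sum.inr ⟨0, 3⟩, Sum.inr ⟨0, 2⟩,
      Sum.inr ⟨0, 1⟩, Sum.inr ⟨0, 0⟩] :
        Fin 6 → Fin 0 ⊕ (Σ _ : Fin 2, Fin 6)) p
  mate_mate := by cases s <;> decide
  mate_ne := by cases s <;> decide
  regOut_last := by decide +revert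
  regIn_last i := by decide +revert
  shade_regOut j := by decide +revert
  shade_regIn i j := by decide +revert
  shade_loopSide l := l.elim
  side_same := by cases s <;> decide
  side_diff := by cases s <;> decide
  connected := connected_of_lt (by cases s <;> decide)
  euler := by
    rw [card_quot_linked_eq_two]
    · simp
    · intro i
      fin_cases i
      · rfl
      · exact (Quot.sound ⟨Sum.inr ⟨0, (0 : Fin 6)⟩, rfl, rfl⟩).symm

/-- The tangle of the closure of `((x₀ * x₁) ∗ (x₂ * x₃)) * (x₄ * x₅)`. -/
def closedConvolution (s : Bool) : PlanarTangle (fun _ : Fin 6 => ((2, s) : Colour)) (0, s) where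
  Region := Fin 8
  Loop := Empty
  finite_input := inferInstance
  finite_region := inferInstance
  finite_loop := inferInstance
  regOut := ![0]
  regIn := ![![0, 5, 4, 1, 0],
    ![0, 3, 4, 5, 0],
    ![4, 6, 2, 1, 4],
    ![4, 3, 2, 6, 4],
    ![0, 7, 2, 3, 0],
    ![0, 1, 2, 7, 0]]
  shade := ![s, !s, s, !s, s, !s, !s, !s]
  loopSide l := l.elim
  mate := fun
    | Sum.inl p => p.elim0
    | Sum.inr ⟨0, p⟩ => (![Sum.inr ⟨1, 3⟩, Sum.inr ⟨1, 2⟩, Sum.inr ⟨2, 3⟩, Sum.inr ⟨5, 0⟩] :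
        Fin 4 → Fin 0 ⊕ (Σ _ : Fin 6, Fin 4)) p
    | Sum.inr ⟨1, p⟩ => (![Sum.inr ⟨4, 3⟩, Sum.inr ⟨3, 0⟩, Sum.inr ⟨0, 1⟩, Sum.inr ⟨0, 0⟩] :
        Fin 4 → Fin 0 ⊕ (Σ _ : Fin 6, Fin 4)) p
    | Sum.inr ⟨2, p⟩ => (![Sum.inr ⟨3, 3⟩, Sum.inr ⟨3, 2⟩, Sum.inr ⟨5, 1⟩, Sum.inr ⟨0, 2⟩] :
        Fin 4 → Fin 0 ⊕ (Σ _ : Fin 6, Fin 4)) p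
    | Sum.inr ⟨3, p⟩ => (![Sum.inr ⟨1, 1⟩, Sum.inr ⟨4, 2⟩, Sum.inr ⟨2, 1⟩, Sum.inr ⟨2, 0⟩] :
        Fin 4 → Fin 0 ⊕ (Σ _ : Fin 6, Fin 4)) p
    | Sum.inr ⟨4, p⟩ => (![Sum.inr ⟨5, 3⟩, Sum.inr ⟨5, 2⟩, Sum.inr ⟨3, 1⟩, Sum.inr ⟨1, 0⟩] :
        Fin 4 → Fin 0 ⊕ (Σ _ : Fin 6, Fin 4)) p
    | Sum.inr ⟨5, p⟩ => (![Sum.inr ⟨0, 3⟩, Sum.inr ⟨2, 2⟩, Sum.inr ⟨4, 1⟩, Sum.inr ⟨4, 0⟩] :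
        Fin 4 → Fin 0 ⊕ (Σ _ : Fin 6, Fin 4)) p
  mate_mate := by cases s <;> decide
  mate_ne := by cases s <;> decide
  regOut_last := by decide +revert
  regIn_last i := by decide +revert
  shade_regOut j := by decide +revert
  shade_regIn i j := by decide +revert
  shade_loopSide l := l.elim
  side_same := by cases s <;> decide
  side_diff := by cases s <;> decide
  connected := connected_of_lt (by cases s <;> decide)
  euler := by
    rw [card_quot_linked_eq_two]
    · simp
    · intro i
      fin_cases i
      · rfl
      · exact (Quot.sound ⟨Sum.inr ⟨0, (0 : Fin 4)⟩, rfl, rfl⟩).symm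
      · exact (Quot.sound ⟨Sum.inr ⟨0, (2 : Fin 4)⟩, rfl, rfl⟩).symm
      · exact ((Quot.sound ⟨Sum.inr ⟨1, (1 : Fin 4)⟩, rfl, rfl⟩).symm).trans
          ((Quot.sound ⟨Sum.inr ⟨0, (0 : Fin 4)⟩, rfl, rfl⟩).symm)
      · exact ((Quot.sound ⟨Sum.inr ⟨1, (0 : Fin 4)⟩, rfl, rfl⟩).symm).trans
          ((Quot.sound ⟨Sum.inr ⟨0, (0 : Fin 4)⟩, rfl, rfl⟩).symm)
      · exact (Quot.sound ⟨Sum.inr ⟨0, (3 : Fin 4)⟩, rfl, rfl⟩).symm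

/-! ### Finite regions and absence of closed strings, for deciding the certificates -/

instance (c : Colour) : Fintype (identity c).Region := inferInstanceAs (Fintype (Fin _))
instance (c : Colour) : DecidableEq (identity c).Region := inferInstanceAs (DecidableEq (Fin _))
instance (c : Colour) : IsEmpty (identity c).Loop := inferInstanceAs (IsEmpty Empty)

instance (c : Colour) : Fintype (closure c).Region := inferInstanceAs (Fintype (Fin _))
instance (c : Colour) : DecidableEq (closure c).Region := inferInstanceAs (DecidableEq (Fin _))
instance (c : Colour) : IsEmpty (closure c).Loop := inferInstanceAs (IsEmpty Empty)

instance (c : Colour) : Fintype (mul c).Region :=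
  inferInstanceAs (Fintype (Fin (c.1 + 1) ⊕ Fin (c.1 - 1) ⊕ Fin (c.1 - 1)))
instance (c : Colour) : DecidableEq (mul c).Region :=
  inferInstanceAs (DecidableEq (Fin (c.1 + 1) ⊕ Fin (c.1 - 1) ⊕ Fin (c.1 - 1)))
instance (c : Colour) : IsEmpty (mul c).Loop := inferInstanceAs (IsEmpty Empty)

instance (s : Bool) : Fintype (rotation s).Region := inferInstanceAs (Fintype (Fin 4))
instance (s : Bool) : DecidableEq (rotation s).Region := inferInstanceAs (DecidableEq (Fin 4))
instance (s : Bool) : IsEmpty (rotation s).Loop := inferInstanceAs (IsEmpty Empty)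

instance (s : Bool) : Fintype (convolution s).Region := inferInstanceAs (Fintype (Fin 5))
instance (s : Bool) : DecidableEq (convolution s).Region := inferInstanceAs (DecidableEq (Fin 5))
instance (s : Bool) : IsEmpty (convolution s).Loop := inferInstanceAs (IsEmpty Empty)

instance (s : Bool) : Fintype (rotationInv s).Region := inferInstanceAs (Fintype (Fin 4))
instance (s : Bool) : DecidableEq (rotationInv s).Region := inferInstanceAs (DecidableEq (Fin 4))
instance (s : Bool) : IsEmpty (rotationInv s).Loop := inferInstanceAs (IsEmpty Empty)

instance (s : Bool) : Fintype (rotationMul s).Region := inferInstanceAs (Fintype (Fin 5))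
instance (s : Bool) : DecidableEq (rotationMul s).Region := inferInstanceAs (DecidableEq (Fin 5))
instance (s : Bool) : IsEmpty (rotationMul s).Loop := inferInstanceAs (IsEmpty Empty)

instance (s : Bool) : Fintype (twoProducts s).Region := inferInstanceAs (Fintype (Fin 7))
instance (s : Bool) : DecidableEq (twoProducts s).Region := inferInstanceAs (DecidableEq (Fin 7))
instance (s : Bool) : IsEmpty (twoProducts s).Loop := inferInstanceAs (IsEmpty Empty)

instance (s : Bool) : Fintype (closedProduct s).Region := inferInstanceAs (Fintype (Fin 4))
instance (s : Bool) : DecidableEq (closedProduct s).Region := inferInstanceAs (DecidableEq (Fin 4))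
instance (s : Bool) : IsEmpty (closedProduct s).Loop := inferInstanceAs (IsEmpty Empty)

instance (s : Bool) : Fintype (closedProductThree s).Region := inferInstanceAs (Fintype (Fin 6))
instance (s : Bool) : DecidableEq (closedProductThree s).Region :=
  inferInstanceAs (DecidableEq (Fin 6))
instance (s : Bool) : IsEmpty (closedProductThree s).Loop := inferInstanceAs (IsEmpty Empty)

instance (s : Bool) : Fintype (closedConvolution s).Region := inferInstanceAs (Fintype (Fin 8))
instance (s : Bool) : DecidableEq (closedConvolution s).Region :=
  inferInstanceAs (DecidableEq (Fin 8))
instance (s : Bool) : IsEmpty (closedConvolution s).Loop := inferInstanceAs (IsEmpty Empty)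

/-! ### Certified decompositions of the tangles -/

/-- The regions in `glueCert_rotation_rotationInv`. -/
def glueMaps_rotation_rotationInv (s : Bool) :
    GlueMaps (rotation s) (fun _ : Unit => rotationInv s)
      (identity (2, !s)) where
  outer := (![1, 2, 3, 0] : Fin 4 → Fin 4)
  inner _ := (![1, 2, 3, 0] : Fin 4 → Fin 4)
  inv := fun
    | ⟨0, _⟩ => Sum.inl (3 : Fin 4)
    | ⟨1, _⟩ => Sum.inl (0 : Fin 4)
    | ⟨2, _⟩ => Sum.inl (1 : Fin 4)
    | ⟨3, _⟩ => Sum.inl (2 : Fin 4)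

theorem glueCert_rotation_rotationInv (s : Bool) :
    GlueCert (fun _ => ⟨(), ()⟩) (glueMaps_rotation_rotationInv s) where
  bijective := by decide
  glue := by cases s <;> decide
  inv_outer := by cases s <;> decide
  inv_inner := by cases s <;> decide
  map_inv := by cases s <;> decide
  shade_outer := by cases s <;> decide
  shade_inner := by cases s <;> decide
  regOut := by cases s <;> decide
  regIn := by cases s <;> decide
  mate := by cases s <;> decide
  circle := by cases s <;> decide

/-- The regions in `glueCert_rotation_mul`. -/
def glueMaps_rotation_mul (s : Bool) :
    GlueMaps (rotation s) (fun _ : Unit => mul (2, s))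
      (rotationMul s) where
  outer := (![1, 2, 3, 0] : Fin 4 → Fin 5)
  inner _ := Sum.elim (![1, 2, 3] : Fin 3 → Fin 5)
      (Sum.elim (![4] : Fin 1 → Fin 5) (![0] : Fin 1 → Fin 5))
  inv := fun
    | ⟨0, _⟩ => Sum.inl (3 : Fin 4)
    | ⟨1, _⟩ => Sum.inl (0 : Fin 4)
    | ⟨2, _⟩ => Sum.inl (1 : Fin 4)
    | ⟨3, _⟩ => Sum.inl (2 : Fin 4)
    | ⟨4, _⟩ => Sum.inr ⟨(), Sum.inr (Sum.inl (0 : Fin 1))⟩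

theorem glueCert_rotation_mul (s : Bool) :
    GlueCert (fun k => ⟨(), k⟩) (glueMaps_rotation_mul s) where
  bijective := by decide
  glue := by cases s <;> decide
  inv_outer := by cases s <;> decide
  inv_inner := by cases s <;> decide
  map_inv := by cases s <;> decide
  shade_outer := by cases s <;> decide
  shade_inner := by cases s <;> decide
  regOut := by cases s <;> decide
  regIn := by cases s <;> decide
  mate := by cases s <;> decide
  circle := by cases s <;> decide

/-- The regions in `glueCert_convolution_rotation`. -/
def glueMaps_convolution_rotation (s : Bool) :
    GlueMaps (convolution (!s)) (fun _ : Fin 2 => rotation s)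
      (rotationMul s) where
  outer := (![0, 1, 2, 3, 4] : Fin 5 → Fin 5)
  inner := fun
    | 0 => (![1, 4, 3, 0] : Fin 4 → Fin 5)
    | 1 => (![1, 2, 3, 4] : Fin 4 → Fin 5)
  inv := fun
    | ⟨0, _⟩ => Sum.inl (0 : Fin 5)
    | ⟨1, _⟩ => Sum.inl (1 : Fin 5)
    | ⟨2, _⟩ => Sum.inl (2 : Fin 5)
    | ⟨3, _⟩ => Sum.inl (3 : Fin 5)
    | ⟨4, _⟩ => Sum.inl (4 : Fin 5)

/-- Turning two stacked boxes together is the same as turning each and placing them side by side: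
`rotationMul` is also the composite in `glueCert_rotation_mul`. The two certificates give
`fourier_mul`. -/
theorem glueCert_convolution_rotation (s : Bool) :
    GlueCert (fun i => ⟨i, ()⟩) (glueMaps_convolution_rotation s) where
  bijective := by decide
  glue := by cases s <;> decide
  inv_outer := by cases s <;> decide
  inv_inner := by cases s <;> decide
  map_inv := by cases s <;> decide
  shade_outer := by cases s <;> decide
  shade_inner := by cases s <;> decide
  regOut := by cases s <;> decide
  regIn := by cases s <;> decide
  mate := by cases s <;> decide
  circle := by cases s <;> decide

/-- The regions in `glueCert_convolution_mul`. -/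
def glueMaps_convolution_mul (s : Bool) :
    GlueMaps (convolution s) (fun _ : Fin 2 => mul (2, s))
      (twoProducts s) where
  outer := (![0, 1, 2, 3, 4] : Fin 5 → Fin 7)
  inner := fun
    | 0 => Sum.elim (![0, 1, 4] : Fin 3 → Fin 7)
      (Sum.elim (![5] : Fin 1 → Fin 7) (![3] : Fin 1 → Fin 7))
    | 1 => Sum.elim (![4, 1, 2] : Fin 3 → Fin 7)
      (Sum.elim (![6] : Fin 1 → Fin 7) (![3] : Fin 1 → Fin 7))
  inv := fun
    | ⟨0, _⟩ => Sum.inl (0 : Fin 5)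
    | ⟨1, _⟩ => Sum.inl (1 : Fin 5)
    | ⟨2, _⟩ => Sum.inl (2 : Fin 5)
    | ⟨3, _⟩ => Sum.inl (3 : Fin 5)
    | ⟨4, _⟩ => Sum.inl (4 : Fin 5)
    | ⟨5, _⟩ => Sum.inr ⟨0, Sum.inr (Sum.inl (0 : Fin 1))⟩
    | ⟨6, _⟩ => Sum.inr ⟨1, Sum.inr (Sum.inl (0 : Fin 1))⟩

theorem glueCert_convolution_mul (s : Bool) :
    GlueCert (![⟨0, 0⟩, ⟨0, 1⟩, ⟨1, 0⟩, ⟨1, 1⟩] : Fin 4 → Σ _ : Fin 2, Fin 2)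
      (glueMaps_convolution_mul s) where
  bijective := by decide
  glue := by cases s <;> decide
  inv_outer := by cases s <;> decide
  inv_inner := by cases s <;> decide
  map_inv := by cases s <;> decide
  shade_outer := by cases s <;> decide
  shade_inner := by cases s <;> decide
  regOut := by cases s <;> decide
  regIn := by cases s <;> decide
  mate := by cases s <;> decide
  circle := by cases s <;> decide

/-- The regions in `glueCert_closure_mul_two`. -/
def glueMaps_closure_mul_two (s : Bool) :
    GlueMaps (closure (2, s)) (fun _ : Unit => mul (2, s))
      (closedProduct s) where
  outer := (![0, 1, 2] : Fin 3 → Fin 4)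
  inner _ := Sum.elim (![0, 1, 2] : Fin 3 → Fin 4)
      (Sum.elim (![3] : Fin 1 → Fin 4) (![1] : Fin 1 → Fin 4))
  inv := fun
    | ⟨0, _⟩ => Sum.inl (0 : Fin 3)
    | ⟨1, _⟩ => Sum.inl (1 : Fin 3)
    | ⟨2, _⟩ => Sum.inl (2 : Fin 3)
    | ⟨3, _⟩ => Sum.inr ⟨(), Sum.inr (Sum.inl (0 : Fin 1))⟩

theorem glueCert_closure_mul_two (s : Bool) :
    GlueCert (fun k => ⟨(), k⟩) (glueMaps_closure_mul_two s) where
  bijective := by decide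
  glue := by cases s <;> decide
  inv_outer := by cases s <;> decide
  inv_inner := by cases s <;> decide
  map_inv := by cases s <;> decide
  shade_outer := by cases s <;> decide
  shade_inner := by cases s <;> decide
  regOut := by cases s <;> decide
  regIn := by cases s <;> decide
  mate := by cases s <;> decide
  circle := by cases s <;> decide

/-- The regions in `glueCert_closure_mul_three`. -/
def glueMaps_closure_mul_three (s : Bool) :
    GlueMaps (closure (3, s)) (fun _ : Unit => mul (3, s))
      (closedProductThree s) where
  outer := (![0, 1, 2, 3] : Fin 4 → Fin 6)
  inner _ := Sum.elim (![0, 1, 2, 3] : Fin 4 → Fin 6)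
      (Sum.elim (![4, 5] : Fin 2 → Fin 6) (![1, 2] : Fin 2 → Fin 6))
  inv := fun
    | ⟨0, _⟩ => Sum.inl (0 : Fin 4)
    | ⟨1, _⟩ => Sum.inl (1 : Fin 4)
    | ⟨2, _⟩ => Sum.inl (2 : Fin 4)
    | ⟨3, _⟩ => Sum.inl (3 : Fin 4)
    | ⟨4, _⟩ => Sum.inr ⟨(), Sum.inr (Sum.inl (0 : Fin 2))⟩
    | ⟨5, _⟩ => Sum.inr ⟨(), Sum.inr (Sum.inl (1 : Fin 2))⟩

theorem glueCert_closure_mul_three (s : Bool) :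
    GlueCert (fun k => ⟨(), k⟩) (glueMaps_closure_mul_three s) where
  bijective := by decide
  glue := by cases s <;> decide
  inv_outer := by cases s <;> decide
  inv_inner := by cases s <;> decide
  map_inv := by cases s <;> decide
  shade_outer := by cases s <;> decide
  shade_inner := by cases s <;> decide
  regOut := by cases s <;> decide
  regIn := by cases s <;> decide
  mate := by cases s <;> decide
  circle := by cases s <;> decide

/-- The tangles that are glued into the two discs of `closedProduct`. -/
def convolutionAndProduct (s : Bool) :
    (i : Fin 2) → PlanarTangle (fun _ : Fin ((![4, 2] : Fin 2 → ℕ) i) => ((2, s) : Colour)) (2, s)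
  | 0 => twoProducts s
  | 1 => mul (2, s)

instance (s : Bool) : ∀ i, Fintype (convolutionAndProduct s i).Region
  | 0 => inferInstanceAs (Fintype (twoProducts s).Region)
  | 1 => inferInstanceAs (Fintype (mul (2, s)).Region)
instance (s : Bool) : ∀ i, DecidableEq (convolutionAndProduct s i).Region
  | 0 => inferInstanceAs (DecidableEq (twoProducts s).Region)
  | 1 => inferInstanceAs (DecidableEq (mul (2, s)).Region)
instance (s : Bool) : ∀ i, IsEmpty (convolutionAndProduct s i).Loop
  | 0 => inferInstanceAs (IsEmpty Empty)
  | 1 => inferInstanceAs (IsEmpty Empty)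

/-- Half of a convolution and its mirror image, glued into the two discs of
`closedProductThree`. -/
def convolutionHalves (s : Bool) :
    Fin 2 → PlanarTangle (fun _ : Fin 3 => ((2, s) : Colour)) (3, s)
  | 0 => (halfConvolution s).reflect
  | 1 => halfConvolution s

instance (s : Bool) : ∀ i, Fintype (convolutionHalves s i).Region
  | 0 => inferInstanceAs (Fintype (Fin 7))
  | 1 => inferInstanceAs (Fintype (Fin 7))
instance (s : Bool) : ∀ i, DecidableEq (convolutionHalves s i).Region
  | 0 => inferInstanceAs (DecidableEq (Fin 7))
  | 1 => inferInstanceAs (DecidableEq (Fin 7))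
instance (s : Bool) : ∀ i, IsEmpty (convolutionHalves s i).Loop
  | 0 => inferInstanceAs (IsEmpty Empty)
  | 1 => inferInstanceAs (IsEmpty Empty)

/-- The regions in `glueCert_closedProduct`. -/
def glueMaps_closedProduct (s : Bool) :
    GlueMaps (closedProduct s) (convolutionAndProduct s)
      (closedConvolution s) where
  outer := (![0, 1, 2, 3] : Fin 4 → Fin 8)
  inner := fun
    | 0 => (![0, 3, 2, 1, 4, 5, 6] : Fin 7 → Fin 8)
    | 1 => Sum.elim (![0, 1, 2] : Fin 3 → Fin 8)
      (Sum.elim (![7] : Fin 1 → Fin 8) (![3] : Fin 1 → Fin 8))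
  inv := fun
    | ⟨0, _⟩ => Sum.inl (0 : Fin 4)
    | ⟨1, _⟩ => Sum.inl (1 : Fin 4)
    | ⟨2, _⟩ => Sum.inl (2 : Fin 4)
    | ⟨3, _⟩ => Sum.inl (3 : Fin 4)
    | ⟨4, _⟩ => Sum.inr ⟨0, (4 : Fin 7)⟩
    | ⟨5, _⟩ => Sum.inr ⟨0, (5 : Fin 7)⟩
    | ⟨6, _⟩ => Sum.inr ⟨0, (6 : Fin 7)⟩
    | ⟨7, _⟩ => Sum.inr ⟨1, Sum.inr (Sum.inl (0 : Fin 1))⟩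

theorem glueCert_closedProduct (s : Bool) :
    GlueCert (![⟨0, (0 : Fin 4)⟩, ⟨0, (1 : Fin 4)⟩, ⟨0, (2 : Fin 4)⟩, ⟨0, (3 : Fin 4)⟩,
      ⟨1, (0 : Fin 2)⟩, ⟨1, (1 : Fin 2)⟩] :
      Fin 6 → Σ i : Fin 2, Fin ((![4, 2] : Fin 2 → ℕ) i)) (glueMaps_closedProduct s) where
  bijective := by decide
  glue := by cases s <;> decide
  inv_outer := by cases s <;> decide
  inv_inner := by cases s <;> decide
  map_inv := by cases s <;> decide
  shade_outer := by cases s <;> decide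
  shade_inner := by cases s <;> decide
  regOut := by cases s <;> decide
  regIn := by cases s <;> decide
  mate := by cases s <;> decide
  circle := by cases s <;> decide

/-- The regions in `glueCert_closedProductThree`. -/
def glueMaps_closedProductThree (s : Bool) :
    GlueMaps (closedProductThree s) (convolutionHalves s)
      (closedConvolution s) where
  outer := (![0, 7, 2, 6, 5, 4] : Fin 6 → Fin 8)
  inner := fun
    | 0 => (![0, 7, 2, 6, 4, 5, 1] : Fin 7 → Fin 8)
    | 1 => (![0, 7, 2, 6, 4, 5, 3] : Fin 7 → Fin 8)
  inv := fun
    | ⟨0, _⟩ => Sum.inl (0 : Fin 6)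
    | ⟨1, _⟩ => Sum.inr ⟨0, (6 : Fin 7)⟩
    | ⟨2, _⟩ => Sum.inl (2 : Fin 6)
    | ⟨3, _⟩ => Sum.inr ⟨1, (6 : Fin 7)⟩
    | ⟨4, _⟩ => Sum.inl (5 : Fin 6)
    | ⟨5, _⟩ => Sum.inl (4 : Fin 6)
    | ⟨6, _⟩ => Sum.inl (3 : Fin 6)
    | ⟨7, _⟩ => Sum.inl (1 : Fin 6)

/-- The cut crosses six strings, two between each of three boxes and its mirror partner, so the
halves are 3-boxes. `glueCert_closedProduct` cuts the same closed tangle between the convolution and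
the remaining product. -/
theorem glueCert_closedProductThree (s : Bool) :
    GlueCert (![⟨0, 0⟩, ⟨1, 0⟩, ⟨0, 1⟩, ⟨1, 1⟩, ⟨1, 2⟩, ⟨0, 2⟩] :
      Fin 6 → Σ _ : Fin 2, Fin 3) (glueMaps_closedProductThree s) where
  bijective := by decide
  glue := by cases s <;> decide
  inv_outer := by cases s <;> decide
  inv_inner := by cases s <;> decide
  map_inv := by cases s <;> decide
  shade_outer := by cases s <;> decide
  shade_inner := by cases s <;> decide
  regOut := by cases s <;> decide
  regIn := by cases s <;> decide
  mate := by cases s <;> decide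
  circle := by cases s <;> decide

end PlanarTangle

/-! ### Perron–Frobenius theory for a multiplicative cone -/

section PerronFrobenius

open Filter Topology

variable {A : Type u} [NormedRing A] [NormedAlgebra ℂ A]

theorem spectralRadius_ne_top_of_normOneClass [CompleteSpace A] [NormOneClass A] (x : A) :
    spectralRadius ℂ x ≠ ⊤ :=
  ((spectrum.spectralRadius_le_nnnorm x).trans_lt ENNReal.coe_lt_top).ne

/-- The power `r ^ (n + 1)` is bounded by the spectral radius of `x ^ (n + 1)`, which is bounded by
its norm. This makes the norm series grow like a geometric series as `t → r`. -/
theorem toReal_spectralRadius_pow_le [CompleteSpace A] [NormOneClass A] (x : A) (n : ℕ) :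
    (spectralRadius ℂ x).toReal ^ (n + 1) ≤ ‖x ^ (n + 1)‖ := by
  rw [← ENNReal.toReal_pow]
  exact ENNReal.toReal_le_of_le_ofReal (norm_nonneg _) (((spectrum.spectralRadius_pow_le x _
    n.succ_ne_zero).trans (spectrum.spectralRadius_le_nnnorm _)).trans_eq (by
      rw [← coe_nnnorm, ENNReal.ofReal_coe_nnreal]))

/-- By Gelfand's formula `‖x ^ n‖ ≤ q ^ n` eventually, for any `q` strictly between the spectral
radius and `t`; compare with the geometric series of ratio `q / t`. -/
theorem summable_norm_resolvent [CompleteSpace A] [NormOneClass A] (x : A) {t : ℝ}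
    (ht : (spectralRadius ℂ x).toReal < t) : Summable fun n : ℕ => t⁻¹ ^ n * ‖x ^ (n + 1)‖ := by
  obtain ⟨q, hq, hqt⟩ := exists_between ht
  have hr0 : 0 ≤ (spectralRadius ℂ x).toReal := ENNReal.toReal_nonneg
  have hq0 : 0 < q := hr0.trans_lt hq
  have ht0 : 0 < t := hq0.trans hqt
  have h1 : spectralRadius ℂ x < ENNReal.ofReal q :=
    (ENNReal.lt_ofReal_iff_toReal_lt (spectralRadius_ne_top_of_normOneClass x)).2 hq
  have h2 := (spectrum.pow_nnnorm_pow_one_div_tendsto_nhds_spectralRadius x).eventually_lt_const h1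
  have h3 : ∀ᶠ n : ℕ in atTop, ‖x ^ n‖ ≤ q ^ n := by
    filter_upwards [h2, eventually_gt_atTop 0] with n hn hn0
    have h4 : ((‖x ^ n‖₊ : ENNReal) ^ (1 / (n : ℝ))) ^ (n : ℝ) ≤ ENNReal.ofReal q ^ (n : ℝ) :=
      ENNReal.rpow_le_rpow hn.le (by positivity)
    rw [← ENNReal.rpow_mul, one_div_mul_cancel (by positivity), ENNReal.rpow_one,
      ENNReal.rpow_natCast, ← ENNReal.ofReal_pow hq0.le, ← ENNReal.ofReal_coe_nnreal,
      ENNReal.ofReal_le_ofReal_iff (by positivity)] at h4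
    exact h4
  have h5 : Summable fun n : ℕ => q * (q / t) ^ n :=
    (summable_geometric_of_lt_one (by positivity) ((div_lt_one ht0).2 hqt)).mul_left q
  refine summable_of_isBigO_nat h5 (Asymptotics.IsBigO.of_bound 1 ?_)
  filter_upwards [(tendsto_add_atTop_nat 1).eventually h3] with n hn
  rw [Real.norm_of_nonneg (by positivity), Real.norm_of_nonneg (by positivity), one_mul]
  calc t⁻¹ ^ n * ‖x ^ (n + 1)‖ ≤ t⁻¹ ^ n * q ^ (n + 1) := by gcongr
    _ = q * (q / t) ^ n := by rw [div_eq_mul_inv, mul_pow]; ring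

/-- A positive functional on a closed cone of a finite-dimensional space dominates the norm. -/
theorem exists_pos_mul_norm_le {E : Type*} [NormedAddCommGroup E] [NormedSpace ℝ E]
    [ProperSpace E] {K : Set E} (hK : IsClosed K)
    (hsmul : ∀ t : ℝ, 0 ≤ t → ∀ a ∈ K, t • a ∈ K) (φ : E →L[ℝ] ℝ)
    (hφ : ∀ a ∈ K, a ≠ 0 → 0 < φ a) : ∃ c > 0, ∀ a ∈ K, c * ‖a‖ ≤ φ a := by
  have hcpt : IsCompact (K ∩ Metric.sphere 0 1) := (isCompact_sphere 0 1).inter_left hK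
  rcases (K ∩ Metric.sphere (0 : E) 1).eq_empty_or_nonempty with he | hne
  -- Here `K` has no nonzero element, so any constant works.
  · refine ⟨1, one_pos, fun a ha => ?_⟩
    by_cases h0 : a = 0
    · simp [h0]
    · have : ‖a‖⁻¹ • a ∈ K ∩ Metric.sphere (0 : E) 1 :=
        ⟨hsmul _ (by positivity) a ha, by simp [norm_smul, h0]⟩
      rw [he] at this
      exact this.elim
  · obtain ⟨b, hb, hmin⟩ := hcpt.exists_isMinOn hne φ.continuous.continuousOn
    have hb0 : b ≠ 0 := by
      rintro rfl
      simpa using hb.2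
    refine ⟨φ b, hφ b hb.1 hb0, fun a ha => ?_⟩
    by_cases h0 : a = 0
    · simp [h0]
    · have h1 : ‖a‖⁻¹ • a ∈ K ∩ Metric.sphere (0 : E) 1 :=
        ⟨hsmul _ (by positivity) a ha, by simp [norm_smul, h0]⟩
      have h2 : φ b ≤ φ (‖a‖⁻¹ • a) := hmin h1
      rw [map_smul, smul_eq_mul, inv_mul_eq_div, le_div_iff₀ (norm_pos_iff.2 h0)] at h2
      exact h2

/-- Perron-Frobenius: in a finite-dimensional Banach algebra with a closed cone that is stable
under products and on which some functional is positive, the spectral radius of an element of the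
cone has an eigenvector in the cone. -/
theorem exists_eigenvector_mem_cone [CompleteSpace A] [NormOneClass A] [FiniteDimensional ℂ A]
    {K : Set A} (hK : IsClosed K) (hadd : ∀ a ∈ K, ∀ b ∈ K, a + b ∈ K)
    (hsmul : ∀ t : ℝ, 0 ≤ t → ∀ a ∈ K, t • a ∈ K) (hmul : ∀ a ∈ K, ∀ b ∈ K, a * b ∈ K)
    (φ : A →L[ℝ] ℝ) (hφ : ∀ a ∈ K, a ≠ 0 → 0 < φ a) {x : A} (hx : x ∈ K) (hx0 : x ≠ 0) :
    ∃ y ∈ K, y ≠ 0 ∧ x * y = (spectralRadius ℂ x).toReal • y ∧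
      y * x = (spectralRadius ℂ x).toReal • y := by
  have : ProperSpace A := FiniteDimensional.proper ℂ A
  obtain ⟨c, hc, hcφ⟩ := exists_pos_mul_norm_le hK hsmul φ hφ
  set r := (spectralRadius ℂ x).toReal with hr
  have hr0 : 0 ≤ r := ENNReal.toReal_nonneg
  have hφ0 : 0 < ‖φ‖ := by
    rw [norm_pos_iff]
    rintro rfl
    simpa using hφ x hx hx0
  have hpow : ∀ n : ℕ, x ^ (n + 1) ∈ K := by
    intro n
    induction n with
    | zero => simpa using hx
    | succ n ih => rw [pow_succ]; exact hmul _ ih _ hx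
  -- This is `t x (t - x)⁻¹`. The series starts at `x` and not at `1`, since `1` is not assumed to
  -- lie in `K`.
  let S : ℝ → A := fun t => ∑' n : ℕ, t⁻¹ ^ n • x ^ (n + 1)
  have hsum : ∀ t, r < t → Summable fun n : ℕ => t⁻¹ ^ n • x ^ (n + 1) := by
    intro t ht
    have ht0 : 0 < t := hr0.trans_lt ht
    refine Summable.of_norm ((summable_norm_resolvent x ht).congr fun n => ?_)
    rw [norm_smul, Real.norm_of_nonneg (by positivity)]
  have hzero : (0 : A) ∈ K := by simpa using hsmul 0 le_rfl x hx
  have hS : ∀ t, r < t → S t ∈ K := by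
    intro t ht
    have ht0 : 0 < t := hr0.trans_lt ht
    refine hK.mem_of_tendsto (hsum t ht).hasSum.tendsto_sum_nat (Eventually.of_forall fun n => ?_)
    induction n with
    | zero => simpa using hzero
    | succ n ih =>
      rw [Finset.sum_range_succ]
      exact hadd _ ih _ (hsmul _ (by positivity) _ (hpow n))
  have hrec : ∀ t, r < t → S t = x + t⁻¹ • (x * S t) := by
    intro t ht
    change ∑' n : ℕ, t⁻¹ ^ n • x ^ (n + 1) = _
    rw [(hsum t ht).tsum_eq_zero_add, ← (hsum t ht).tsum_mul_left,
      ← ((hsum t ht).mul_left x).tsum_const_smul]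
    simp only [pow_zero, one_smul, zero_add, pow_one]
    congr 1
    refine tsum_congr fun n => ?_
    rw [mul_smul_comm, smul_smul, ← pow_succ', ← pow_succ']
  have hcomm : ∀ t, r < t → x * S t = S t * x := by
    intro t ht
    change x * ∑' n : ℕ, t⁻¹ ^ n • x ^ (n + 1) = (∑' n : ℕ, t⁻¹ ^ n • x ^ (n + 1)) * x
    rw [← (hsum t ht).tsum_mul_left, ← (hsum t ht).tsum_mul_right]
    refine tsum_congr fun n => ?_
    rw [mul_smul_comm, smul_mul_assoc, ← pow_succ, ← pow_succ']
  -- Applying `φ` term by term bounds the norm of the sum from below by the sum of the norms, up to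
  -- constants.
  have hlow : ∀ t, r < t → c * ∑' n : ℕ, t⁻¹ ^ n * ‖x ^ (n + 1)‖ ≤ ‖φ‖ * ‖S t‖ := by
    intro t ht
    have ht0 : 0 < t := hr0.trans_lt ht
    refine le_trans ?_ ((le_abs_self _).trans (φ.le_opNorm (S t)))
    change _ ≤ φ (∑' n : ℕ, t⁻¹ ^ n • x ^ (n + 1))
    rw [φ.map_tsum (hsum t ht), ← tsum_mul_left]
    refine ((summable_norm_resolvent x ht).mul_left c).tsum_le_tsum (fun n => ?_)
      ((hsum t ht).mapL φ)
    rw [map_smul, smul_eq_mul, mul_left_comm]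
    exact mul_le_mul_of_nonneg_left (hcφ _ (hpow n)) (by positivity)
  -- The form in which the error term `t • x / ‖S t‖` is seen to vanish as `t → r`. For `r = 0` the
  -- geometric lower bound is zero, but `t - r = t`, so it suffices that the first term `‖x‖` keeps
  -- `‖S t‖` away from `0`.
  obtain ⟨B, hB⟩ : ∃ B : ℝ, ∀ t, r < t → t ≤ B * (t - r) * ‖S t‖ := by
    rcases hr0.eq_or_lt with h0 | h0
    · refine ⟨‖φ‖ / (c * ‖x‖), fun t ht => ?_⟩
      have ht0 : 0 < t := hr0.trans_lt ht
      have h1 : ‖x‖ ≤ ∑' n : ℕ, t⁻¹ ^ n * ‖x ^ (n + 1)‖ := by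
        simpa using (summable_norm_resolvent x ht).le_tsum 0 (fun n _ => by positivity)
      have h2 : c * ‖x‖ ≤ ‖φ‖ * ‖S t‖ := (mul_le_mul_of_nonneg_left h1 hc.le).trans (hlow t ht)
      have h3 : 0 < c * ‖x‖ := mul_pos hc (norm_pos_iff.2 hx0)
      rw [← h0, sub_zero, div_mul_eq_mul_div, div_mul_eq_mul_div, le_div_iff₀ h3]
      nlinarith
    · refine ⟨‖φ‖ / (c * r), fun t ht => ?_⟩
      have ht0 : 0 < t := hr0.trans_lt ht
      have h1 : HasSum (fun n : ℕ => r * (r / t) ^ n) (r * (1 - r / t)⁻¹) :=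
        (hasSum_geometric_of_lt_one (by positivity) ((div_lt_one ht0).2 ht)).mul_left r
      have h2 : r * (1 - r / t)⁻¹ ≤ ∑' n : ℕ, t⁻¹ ^ n * ‖x ^ (n + 1)‖ := by
        refine hasSum_le (fun n => ?_) h1 (summable_norm_resolvent x ht).hasSum
        calc r * (r / t) ^ n = t⁻¹ ^ n * r ^ (n + 1) := by rw [div_eq_mul_inv, mul_pow]; ring
          _ ≤ _ := mul_le_mul_of_nonneg_left (toReal_spectralRadius_pow_le x n) (by positivity)
      have h3 := (mul_le_mul_of_nonneg_left h2 hc.le).trans (hlow t ht)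
      have h4 : r * (1 - r / t)⁻¹ = r * t / (t - r) := by
        have : t - r ≠ 0 := (sub_pos.2 ht).ne'
        rw [one_sub_div ht0.ne', inv_div, mul_div_assoc]
      rw [h4, ← mul_div_assoc, div_le_iff₀ (sub_pos.2 ht)] at h3
      rw [div_mul_eq_mul_div, div_mul_eq_mul_div, le_div_iff₀ (by positivity)]
      nlinarith
  let t : ℕ → ℝ := fun k => r + 1 / ((k : ℝ) + 1)
  have ht : ∀ k, r < t k := fun k => by
    have : (0 : ℝ) < 1 / ((k : ℝ) + 1) := by positivity
    simpa [t] using this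
  have htlim : Tendsto t atTop (𝓝 r) := by
    simpa [t] using tendsto_one_div_add_atTop_nhds_zero_nat.const_add r
  have hSpos : ∀ k, 0 < ‖S (t k)‖ := by
    intro k
    refine (norm_nonneg _).lt_of_ne fun h => ?_
    have := hB _ (ht k)
    rw [← h, mul_zero] at this
    exact (hr0.trans_lt (ht k)).not_ge this
  let y : ℕ → A := fun k => ‖S (t k)‖⁻¹ • S (t k)
  have hyK : ∀ k, y k ∈ K ∩ Metric.sphere 0 1 := fun k =>
    ⟨hsmul _ (by positivity) _ (hS _ (ht k)), by
      simp [y, norm_smul, (hSpos k).ne']⟩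
  -- Lying on the unit sphere keeps the limit nonzero.
  obtain ⟨z, hz, σ, hσ, hlim⟩ :=
    ((isCompact_sphere (0 : A) 1).inter_left hK).tendsto_subseq hyK
  have herr : Tendsto (fun k => (t k * ‖S (t k)‖⁻¹) • x) atTop (𝓝 0) := by
    rw [← zero_smul ℝ x]
    refine Tendsto.smul_const ?_ x
    have h1 : Tendsto (fun k => B * (t k - r)) atTop (𝓝 0) := by
      simpa using (htlim.sub_const r).const_mul B
    refine squeeze_zero (fun k => ?_) (fun k => ?_) h1
    · exact mul_nonneg (hr0.trans (ht k).le) (by positivity)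
    · rw [← div_eq_mul_inv, div_le_iff₀ (hSpos k)]
      exact hB _ (ht k)
  have hyrec : ∀ k, x * y k = t k • y k - (t k * ‖S (t k)‖⁻¹) • x := by
    intro k
    have ht0 : t k ≠ 0 := (hr0.trans_lt (ht k)).ne'
    have h1 : x * S (t k) = t k • S (t k) - t k • x := by
      have h2 := congrArg (fun a => t k • a) (hrec _ (ht k))
      simp only [smul_add, smul_smul, mul_inv_cancel₀ ht0, one_smul] at h2
      rw [h2, add_sub_cancel_left]
    simp only [y]
    rw [mul_smul_comm, h1, smul_sub, smul_comm, smul_smul ‖S (t k)‖⁻¹ (t k) x,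
      mul_comm ‖S (t k)‖⁻¹ (t k)]
  have hxz : x * z = r • z := by
    have h1 : Tendsto (fun k => x * y (σ k)) atTop (𝓝 (x * z)) := hlim.const_mul x
    have h2 : Tendsto (fun k => t (σ k) • y (σ k) - (t (σ k) * ‖S (t (σ k))‖⁻¹) • x) atTop
        (𝓝 (r • z - 0)) :=
      ((htlim.comp hσ.tendsto_atTop).smul hlim).sub (herr.comp hσ.tendsto_atTop)
    rw [sub_zero] at h2
    exact tendsto_nhds_unique (h1.congr fun k => hyrec _) h2
  have hzx : z * x = x * z := by
    have h1 : Tendsto (fun k => x * y (σ k)) atTop (𝓝 (x * z)) := hlim.const_mul x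
    have h2 : Tendsto (fun k => y (σ k) * x) atTop (𝓝 (z * x)) := hlim.mul_const x
    refine tendsto_nhds_unique h2 (h1.congr fun k => ?_)
    simp only [y]
    rw [mul_smul_comm, smul_mul_assoc, hcomm _ (ht _)]
  refine ⟨z, hz.1, ?_, hxz, hzx.trans hxz⟩
  rintro rfl
  simpa using hz.2

end PerronFrobenius

/-! ### Mirror symmetry of the convolution -/

namespace PlanarTangle

/-- Reflection in a horizontal line fixes both discs and exchanges the top region `1` with the
bottom region `3`. -/
theorem isRelabelling_convolution_reflect (s : Bool) :
    IsRelabelling (Equiv.refl (Fin 2)) (convolution s).reflect (convolution s) := by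
  refine ⟨(Equiv.swap (1 : Fin 5) 3 : Fin 5 ≃ Fin 5), Equiv.refl Empty, ?_, ?_, ?_,
    fun l => l.elim, ?_⟩
  · intro j
    cases s <;> fin_cases j <;> rfl
  · intro i j
    cases s <;> fin_cases i <;> fin_cases j <;> rfl
  · intro r
    cases s <;> fin_cases r <;> decide
  · cases s <;> decide

end PlanarTangle

/-! ### Fourier transform, trace and Schur product theorem -/

namespace CStarPlanarAlgebra

open PlanarTangle

variable (P : CStarPlanarAlgebra.{u}) {s : Bool}

instance (c : Colour) : FiniteDimensional ℂ (P.V c) := P.finiteDimensional c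

/-- The map of a tangle with one input disc, as a linear map. -/
noncomputable def linearZ {c out : Colour} (T : PlanarTangle (fun _ : Unit => c) out) :
    P.V c →ₗ[ℂ] P.V out :=
  (P.Z T).toLinearMap 0 ()

theorem linearZ_apply {c out : Colour} (T : PlanarTangle (fun _ : Unit => c) out) (x : P.V c) :
    P.linearZ T x = P.Z T (fun _ => x) := by
  refine congrArg (P.Z T) (funext fun i => ?_)
  cases i
  exact Function.update_self (β := fun _ : Unit => P.V c) () x 0

theorem fourier_eq_linearZ (x : P.V (2, s)) : P.fourier x = P.linearZ (rotation s) x :=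
  (P.linearZ_apply _ x).symm

theorem linearZ_rotation_surjective (s : Bool) :
    Function.Surjective (P.linearZ (rotation s)) := by
  intro b
  refine ⟨P.Z (rotationInv s) (fun _ => b), ?_⟩
  rw [linearZ_apply]
  exact (P.Z_glue (glueCert_rotation_rotationInv s) (fun _ => b)).symm.trans
    (P.Z_identity (2, !s) b)

/-- Surjectivity for both shadings makes the dimensions of `P_{2,+}` and `P_{2,-}` equal, so the
other composite with `rotationInv` need not be examined. -/
theorem linearZ_rotation_injective (s : Bool) :
    Function.Injective (P.linearZ (rotation s)) := by
  have h1 := LinearMap.finrank_le_finrank_of_surjective (P.linearZ_rotation_surjective s)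
  have h2 := LinearMap.finrank_le_finrank_of_surjective (P.linearZ_rotation_surjective (!s))
  rw [Bool.not_not] at h2
  exact (LinearMap.injective_iff_surjective_of_finrank_eq_finrank (h2.antisymm h1)).2
    (P.linearZ_rotation_surjective s)

theorem fourier_mul (x y : P.V (2, s)) :
    P.fourier (x * y) = P.conv (P.fourier x) (P.fourier y) := by
  have h1 := P.Z_glue (glueCert_rotation_mul s) (fun p => (![x, y] : Fin 2 → P.V (2, s)) p.2)
  have h2 := P.Z_glue (glueCert_convolution_rotation s)
    (fun p => (![x, y] : Fin 2 → P.V (2, s)) p.1)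
  rw [P.mul_eq]
  refine (h1.symm.trans h2).trans (congrArg (P.Z (convolution (!s))) (funext fun i => ?_))
  fin_cases i <;> rfl

/-- The trace `tr_{n,±}`. -/
noncomputable def tr {c : Colour} : P.V c →ₗ[ℂ] ℂ := P.trZero c.2 ∘ₗ P.linearZ (closure c)

theorem tr_apply {c : Colour} (x : P.V c) :
    P.tr x = P.trZero c.2 (P.Z (closure c) (fun _ => x)) :=
  congrArg (P.trZero c.2) (P.linearZ_apply _ x)

theorem tr_star_mul_self_pos {c : Colour} {x : P.V c} (hx : x ≠ 0) :
    0 < (P.tr (star x * x)).re := by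
  obtain ⟨t, ht, h⟩ := P.trace_pos c x hx
  rw [tr_apply, h]
  exact ht

theorem tr_star_mul_self_nonneg {c : Colour} (x : P.V c) : 0 ≤ (P.tr (star x * x)).re := by
  by_cases hx : x = 0
  · simp [hx]
  · exact (P.tr_star_mul_self_pos hx).le

theorem star_conv (a b : P.V (2, s)) : star (P.conv a b) = P.conv (star a) (star b) := by
  have h := P.Z_relabel (Equiv.refl (Fin 2)) _ _ (isRelabelling_convolution_reflect s)
    ![star a, star b]
  rw [conv, P.Z_star]
  refine Eq.trans (congrArg (P.Z (convolution s).reflect) (funext fun i => ?_)) h.symm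
  fin_cases i <;> rfl

/-- The closure of `((star z * z) ∗ (star w * w)) * (k * star k)` is cut into two halves that are
mirror images of each other. -/
theorem tr_conv_mul (z w k : P.V (2, s)) :
    P.tr (P.conv (star z * z) (star w * w) * (k * star k)) =
      P.tr (star (P.Z (halfConvolution s) ![z, w, k]) * P.Z (halfConvolution s) ![z, w, k]) := by
  have h1 := P.Z_glue (glueCert_convolution_mul s)
    (fun p => (![![star z, z], ![star w, w]] : Fin 2 → Fin 2 → P.V (2, s)) p.1 p.2)
  have h2 := P.Z_glue (glueCert_closure_mul_two s)
    (fun p => (![P.conv (star z * z) (star w * w), k * star k] : Fin 2 → P.V (2, s)) p.2)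
  have h3 := P.Z_glue (glueCert_closure_mul_three s)
    (fun p => (![star (P.Z (halfConvolution s) ![z, w, k]),
      P.Z (halfConvolution s) ![z, w, k]] : Fin 2 → P.V (3, s)) p.2)
  have h4 := P.Z_glue (glueCert_closedProduct s) (fun
    | ⟨0, a⟩ => (![star z, z, star w, w] : Fin 4 → P.V (2, s)) a
    | ⟨1, a⟩ => (![k, star k] : Fin 2 → P.V (2, s)) a)
  have h5 := P.Z_glue (glueCert_closedProductThree s)
    (fun p => (![![star z, star w, star k], ![z, w, k]] : Fin 2 → Fin 3 → P.V (2, s)) p.1 p.2)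
  have h6 : P.conv (star z * z) (star w * w) =
      P.Z (twoProducts s) ![star z, z, star w, w] := by
    refine Eq.trans (congrArg (P.Z (convolution s)) (funext fun i => ?_)) (h1.symm.trans
      (congrArg (P.Z (twoProducts s)) (funext fun i => ?_)))
    · fin_cases i
      · exact P.mul_eq _ _ _
      · exact P.mul_eq _ _ _
    · fin_cases i <;> rfl
  have h7 : star (P.Z (halfConvolution s) ![z, w, k]) =
      P.Z (halfConvolution s).reflect ![star z, star w, star k] := by
    rw [P.Z_star]
    refine congrArg (P.Z (halfConvolution s).reflect) (funext fun i => ?_)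
    fin_cases i <;> rfl
  rw [tr_apply, tr_apply]
  refine congrArg (P.trZero s) ?_
  rw [P.mul_eq, P.mul_eq _ (star (P.Z (halfConvolution s) ![z, w, k]))]
  refine (h2.symm.trans ?_).trans h3
  -- Both closures are evaluated as `closedConvolution` on the same six boxes, once for each way of
  -- cutting it.
  have h8 : P.Z (closedProduct s) ![P.conv (star z * z) (star w * w), k * star k] =
      P.Z (closedConvolution s) ![star z, z, star w, w, k, star k] := by
    refine Eq.trans (congrArg (P.Z (closedProduct s)) (funext fun i => ?_)) (h4.symm.trans
      (congrArg (P.Z (closedConvolution s)) (funext fun i => ?_)))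
    · fin_cases i
      · exact h6
      · exact P.mul_eq _ _ _
    · fin_cases i <;> rfl
  have h9 : P.Z (closedProductThree s) ![star (P.Z (halfConvolution s) ![z, w, k]),
      P.Z (halfConvolution s) ![z, w, k]] =
      P.Z (closedConvolution s) ![star z, z, star w, w, k, star k] := by
    refine Eq.trans (congrArg (P.Z (closedProductThree s)) (funext fun i => ?_)) (h5.symm.trans
      (congrArg (P.Z (closedConvolution s)) (funext fun i => ?_)))
    · fin_cases i
      · exact h7
      · rfl
    · fin_cases i <;> rfl
  exact h8.trans h9.symm

/-- The Schur product theorem: the convolution of positive elements is positive. -/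
theorem exists_conv_eq_mul_star (a b : P.V (2, s)) :
    ∃ c, P.conv (a * star a) (b * star b) = c * star c := by
  let _ := CStarAlgebra.spectralOrder (P.V (2, s))
  have := CStarAlgebra.spectralOrderedRing (P.V (2, s))
  rw [← CStarAlgebra.nonneg_iff_eq_mul_star_self]
  set h := P.conv (a * star a) (b * star b) with hh
  have hsa : IsSelfAdjoint h := by
    rw [isSelfAdjoint_iff, hh, star_conv, star_mul, star_mul, star_star, star_star]
  obtain ⟨k, hk⟩ := CStarAlgebra.nonneg_iff_eq_mul_star_self.1 (CFC.negPart_nonneg h)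
  -- `tr_conv_mul` is applied to `star a` and `star b`, since `a * star a = star (star a) * star a`.
  have h1 : 0 ≤ (P.tr (h * h⁻)).re := by
    have := P.tr_conv_mul (star a) (star b) k
    rw [star_star, star_star, ← hh, ← hk] at this
    rw [this]
    exact P.tr_star_mul_self_nonneg _
  -- With `h = h⁺ - h⁻` and `h⁺ * h⁻ = 0` only the square of `h⁻` survives.
  have h2 : h * h⁻ = -(star h⁻ * h⁻) := by
    rw [(IsSelfAdjoint.of_nonneg (CFC.negPart_nonneg h)).star_eq]
    nth_rewrite 1 [← CFC.posPart_sub_negPart h hsa]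
    rw [sub_mul, CFC.posPart_mul_negPart, zero_sub]
  rw [← CFC.negPart_eq_zero_iff h hsa]
  by_contra h0
  have h3 := P.tr_star_mul_self_pos h0
  rw [h2, map_neg, Complex.neg_re] at h1
  linarith

end CStarPlanarAlgebra

/-! ### The proposition -/

open CStarPlanarAlgebra in
theorem proposition3p1 (P : CStarPlanarAlgebra.{u}) (s : Bool) [Nontrivial (P.V (2, s))]
    (x : P.V (2, s)) (hx : P.FPositive x) :
    ∃ y : P.V (2, s), y ≠ 0 ∧ P.FPositive y ∧
      x * y = ((spectralRadius ℂ x).toReal : ℂ) • y ∧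
      y * x = ((spectralRadius ℂ x).toReal : ℂ) • y ∧
      P.conv (P.fourier x) (P.fourier y) =
        ((spectralRadius ℂ x).toReal : ℂ) • P.fourier y ∧
      P.conv (P.fourier y) (P.fourier x) =
        ((spectralRadius ℂ x).toReal : ℂ) • P.fourier y := by
  let _ := CStarAlgebra.spectralOrder (P.V (2, !s))
  have := CStarAlgebra.spectralOrderedRing (P.V (2, !s))
  have hF : ∀ a : P.V (2, s), P.FPositive a ↔ 0 ≤ P.linearZ (PlanarTangle.rotation s) a := by
    intro a
    rw [CStarAlgebra.nonneg_iff_eq_mul_star_self, ← fourier_eq_linearZ]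
    rfl
  suffices h : ∃ y : P.V (2, s), y ≠ 0 ∧ P.FPositive y ∧
      x * y = ((spectralRadius ℂ x).toReal : ℂ) • y ∧
      y * x = ((spectralRadius ℂ x).toReal : ℂ) • y by
    obtain ⟨y, hy0, hy, h1, h2⟩ := h
    refine ⟨y, hy0, hy, h1, h2, ?_, ?_⟩
    · rw [← fourier_mul, h1, fourier_eq_linearZ, map_smul, ← fourier_eq_linearZ]
    · rw [← fourier_mul, h2, fourier_eq_linearZ, map_smul, ← fourier_eq_linearZ]
  have hcont : Continuous (P.linearZ (PlanarTangle.rotation s)) :=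
    LinearMap.continuous_of_finiteDimensional _
  -- For `x = 0` every `y` satisfies the equations with `r = 0`. The preimage of `1` under `𝔉` is a
  -- nonzero `𝔉`-positive choice.
  by_cases hx0 : x = 0
  · obtain ⟨y, hy⟩ := P.linearZ_rotation_surjective s 1
    refine ⟨y, ?_, (hF y).2 (by rw [hy]; exact zero_le_one), by simp [hx0], by simp [hx0]⟩
    rintro rfl
    rw [map_zero] at hy
    have : Subsingleton (P.V (2, !s)) := subsingleton_of_zero_eq_one hy
    exact not_subsingleton _ (P.linearZ_rotation_injective s).subsingleton
  · let φ : P.V (2, s) →L[ℂ] ℂ :=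
      LinearMap.toContinuousLinearMap (P.tr ∘ₗ P.linearZ (PlanarTangle.rotation s))
    obtain ⟨y, hy, hy0, h1, h2⟩ := exists_eigenvector_mem_cone (K := {a | P.FPositive a})
      (by
        simp only [hF]
        exact CStarAlgebra.isClosed_nonneg.preimage hcont)
      (by
        intro a ha b hb
        rw [Set.mem_ofPred_eq, hF] at *
        rw [map_add]
        exact add_nonneg ha hb)
      (by
        intro t ht a ha
        rw [Set.mem_ofPred_eq, hF] at *
        -- The rotation is only given as a `ℂ`-linear map, so the real scalar passes through `ℂ`.
        rw [← Complex.coe_smul, map_smul, Complex.coe_smul]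
        exact smul_nonneg ht ha)
      (by
        rintro a ⟨a', ha⟩ b ⟨b', hb⟩
        obtain ⟨c, hc⟩ := P.exists_conv_eq_mul_star a' b'
        exact ⟨c, by rw [fourier_mul, ha, hb, hc]⟩)
      (Complex.reCLM.comp (φ.restrictScalars ℝ))
      (by
        rintro a ⟨b, hb⟩ ha0
        change 0 < (P.tr (P.linearZ (PlanarTangle.rotation s) a)).re
        rw [← fourier_eq_linearZ, hb]
        -- The trace is faithful in the form `star c * c`, so it is used with `c = star b`, which
        -- vanishes only if `𝔉 a` does.
        have hb0 : star b ≠ 0 := by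
          intro h0
          refine ha0 (P.linearZ_rotation_injective s ?_)
          rw [← fourier_eq_linearZ, hb, h0, mul_zero, map_zero]
        simpa using P.tr_star_mul_self_pos hb0)
      hx hx0
    exact ⟨y, hy0, hy, by rw [h1, Complex.coe_smul], by rw [h2, Complex.coe_smul]⟩
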